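/- Consider the sum classic network creation game on a finite set $V$ of $n$ players with link price $\alpha$: a strategy of player $u$ is a set $s_u \subseteq V\setminus\{u\}$, a strategy vector $s=(s_u)_{u\in V}$ determines the undirected graph $G_s=(V,\{uv : v\in s_u \text{ or } u\in s_v\})$, and the cost of $u$ is $c_u(s)=\alpha|s_u|+\sum_{v\ne u} d_{G_s}(u,v)$, where the distance between vertices in different connected components is $+\infty$. The vector $s$ is a Nash equilibrium if $c_u(s)\le c_u(s')$ for every player $u$ and every strategy vector $s'$ that differs from $s$ only in the strategy of $u$. A graph is biconnected if it is connected and has no cut vertex; a biconnected component of $G$ is a maximal biconnected subgraph of $G$, and it is non-trivial if it has at least three vertices. For a biconnected component $H$ of $G$ and $u\in V(H)$, let $T(u)$ be the vertex set of the connected component containing $u$ of the subgraph of $G$ induced by $(V(G)\setminus V(H))\cup\{u\}$. Proposition. Let $\alpha>n$, let $G=G_s$ for a Nash equilibrium $s$, and let $H\subseteq G$ be a non-trivial biconnected component of $G$. Then $d_G(u,v)\le 77$ for every $u\in V(H)$ and every $v\in T(u)$, and $$\operatorname{diam}(G)\le \operatorname{diam}(H)+154.$$ -/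

import Mathlib

open scoped ENNReal

namespace NetworkCreation

/-- A (pure) strategy of player `u`: a set of other players to whom `u` buys a link. -/
abbrev Strategy {V : Type*} (u : V) : Type _ := {S : Finset V // u ∉ S}

/-- A strategy vector. -/
abbrev Profile (V : Type*) : Type _ := (u : V) → Strategy u

/-- The (undirected) communication network of a strategy vector. -/
def network {V : Type*} (s : Profile V) : SimpleGraph V where
  Adj u v := v ∈ (s u).1 ∨ u ∈ (s v).1
  symm := ⟨fun _ _ h => h.symm⟩
  loopless := ⟨fun u h => h.elim (s u).2 (s u).2⟩

/-- The cost of player `u`: the price of the links bought by `u` plus the sum of the distances from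
`u` to all the other players. Distances are extended, so that the cost is infinite when some
player cannot be reached from `u`. -/
noncomputable def cost {V : Type*} [Fintype V] [DecidableEq V] (α : ℝ) (s : Profile V) (u : V) :
    ℝ≥0∞ :=
  ENNReal.ofReal α * ((s u).1.card : ℝ≥0∞) +
    ∑ v ∈ Finset.univ.erase u, (((network s).edist u v : ℕ∞) : ℝ≥0∞)

/-- A Nash equilibrium: no player can strictly decrease her own cost by changing her strategy. -/
def IsNashEquilibrium {V : Type*} [Fintype V] [DecidableEq V] (α : ℝ) (s : Profile V) : Prop :=
  ∀ (u : V) (t : Strategy u), cost α s u ≤ cost α (Function.update s u t) u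

/-- A cut vertex of a connected graph: its removal leaves more than one connected component. -/
def IsCutVertex {W : Type*} (G : SimpleGraph W) (v : W) : Prop :=
  G.Connected ∧ ¬ (G.induce {v}ᶜ).Preconnected

/-- A graph is biconnected if it is connected and has no cut vertices. -/
def IsBiconnected {W : Type*} (G : SimpleGraph W) : Prop :=
  G.Connected ∧ ∀ v, ¬ IsCutVertex G v

/-- A biconnected component of `G`: a maximal biconnected subgraph. -/
def IsBiconnectedComponent {V : Type*} {G : SimpleGraph V} (H : G.Subgraph) : Prop :=
  Maximal (fun K : G.Subgraph => IsBiconnected K.coe) H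

/-- A biconnected component is non-trivial if it has at least three vertices, that is, if it is
neither a single vertex nor a single edge. -/
def IsNontrivialBiconnectedComponent {V : Type*} {G : SimpleGraph V} (H : G.Subgraph) : Prop :=
  IsBiconnectedComponent H ∧ 3 ≤ H.verts.encard

/-- `T(u)`: the vertex set of the connected component containing `u` of the subgraph of `G`
induced by `(V(G) \ V(H)) ∪ {u}`. -/
def attached {V : Type*} {G : SimpleGraph V} (H : G.Subgraph) (u : V) : Set V :=
  {v | ∃ hv : v ∈ insert u H.vertsᶜ,
    (G.induce (insert u H.vertsᶜ)).Reachable ⟨u, Set.mem_insert u _⟩ ⟨v, hv⟩}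

end NetworkCreation

/-! The proof splits at `α = 11n`. Above that price an equilibrium has no cycle (`not_nonBridge`),
so a non-trivial biconnected component cannot exist. Below it, three deviations bound the depth of
every `T(u)` (`dist_le_of_mem_attached_aux`).

Case `α > 11n`. Take a breadth first tree rooted at a vertex `r` of least total distance and count
the non-bridge edges at the vertices they touch. A buyer of a non-tree edge buys no other edge
useful enough to be traded, together with that one, for a single link to `r` (`le_of_two_special`).
It follows that such a buyer buys only one non-tree edge, and that its tree edges upwards are bought
from above for five levels, so the six-vertex chains above different buyers are disjoint
(`iterate_inj`). Hence the average non-bridge degree is at most 7/3. On the other hand, a vertex of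
non-bridge degree two buys neither of these edges (`not_owner_of_two_nonBridge`), so all its
non-bridge neighbours have degree at least three, and the average is at least 12/5.

Case `n < α ≤ 11n`. Root the tree at `u`. The component contains a non-tree edge, bought by some
`x`. Let `q` be the number of vertices outside `T(u)` and `δ` the distance from `x` to `u`. Dropping
the edge gives `α ≤ 2δq`, and exchanging it for a link to `u` gives `δ(n - 2q) ≤ n`. A vertex of
`T(u)` more than 77 away from `u` could buy a link to `u`, so `77q ≤ α ≤ 11n`. Then `7q ≤ n`, whence
`5δq ≤ n` and `α ≤ 2n/5`, which is absurd. -/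

namespace NetworkCreation

/-! ### Upper and lower bounds on distances by potentials. -/

section Distance

variable {V : Type*} {G : SimpleGraph V}

lemma edist_le_succ_of_adj {x y z : V} {n : ℕ} (hyz : G.Adj y z) (h : G.edist x y ≤ n) :
    G.edist x z ≤ (n + 1 : ℕ) := by
  have h1 : G.edist y z ≤ 1 := SimpleGraph.edist_le_one_iff_adj_or_eq.2 (Or.inl hyz)
  calc G.edist x z ≤ G.edist x y + G.edist y z := SimpleGraph.edist_triangle
    _ ≤ n + 1 := add_le_add h h1
    _ = (n + 1 : ℕ) := by push_cast; rfl

lemma edist_le_of_le {x z : V} {m n : ℕ} (h : G.edist x z ≤ m) (hmn : m ≤ n) :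
    G.edist x z ≤ n := h.trans (by exact_mod_cast hmn)

lemma edist_le_of_adj {x z : V} {n : ℕ} (h : G.Adj x z) (hn : 1 ≤ n) : G.edist x z ≤ n :=
  (SimpleGraph.edist_le_one_iff_adj_or_eq.2 (Or.inl h)).trans (by exact_mod_cast hn)

lemma edist_self_le {x : V} {n : ℕ} : G.edist x x ≤ n := by simp

/-- This is the tool for distances after a deviation: old shortest or tree paths supply the
predecessors `y`, and the vertices whose last edge was removed are bounded directly. -/
lemma edist_le_of_descent {x : V} (S : Set V) (f : V → ℕ)
    (h : ∀ z ∈ S, G.edist x z ≤ f z ∨ ∃ y ∈ S, G.Adj y z ∧ f y + 1 ≤ f z) :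
    ∀ z ∈ S, G.edist x z ≤ f z := by
  suffices H : ∀ n, ∀ z ∈ S, f z = n → G.edist x z ≤ f z from fun z hz => H _ z hz rfl
  intro n
  induction n using Nat.strong_induction_on with
  | _ n ih =>
    intro z hz hn
    rcases h z hz with h | ⟨y, hy, hyz, hf⟩
    · exact h
    · exact edist_le_of_le (edist_le_succ_of_adj hyz (ih (f y) (by omega) y hy rfl)) hf

/-- A function that grows by at most one along each edge grows by at most the length of a walk.
Lower bounds on distances across cut sets come from here. -/
lemma le_dist_of_lipschitz (hG : G.Connected) (F : V → ℕ)
    (h : ∀ a b, G.Adj a b → F b ≤ F a + 1) {y : V} (hy : F y = 0) (z : V) :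
    F z ≤ G.dist y z := by
  obtain ⟨p, hp⟩ := hG.exists_walk_length_eq_dist y z
  have key : ∀ {a b : V} (p : G.Walk a b), F b ≤ F a + p.length := by
    intro a b p
    induction p with
    | nil => simp
    | cons hab p ih =>
      have := h _ _ hab
      rw [SimpleGraph.Walk.length_cons]; omega
  have := key p
  omega

lemma exists_adj_dist_succ {x z : V} (h : G.Reachable x z) (hne : z ≠ x) :
    ∃ y, G.Adj y z ∧ G.Reachable x y ∧ G.dist x y + 1 = G.dist x z := by
  obtain ⟨p, hp⟩ := h.symm.exists_walk_length_eq_dist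
  cases p with
  | nil => exact absurd rfl hne
  | cons hzy q =>
    rename_i y
    refine ⟨y, hzy.symm, q.reachable.symm, ?_⟩
    rw [SimpleGraph.Walk.length_cons] at hp
    have h1 : G.dist x y ≤ q.length := by
      rw [SimpleGraph.dist_comm]; exact SimpleGraph.dist_le q
    have h2 : G.dist x z ≤ G.dist x y + 1 := by
      obtain ⟨q', hq'⟩ := q.reachable.symm.exists_walk_length_eq_dist
      have := SimpleGraph.dist_le (q'.concat hzy.symm)
      rw [SimpleGraph.Walk.length_concat] at this
      omega
    rw [SimpleGraph.dist_comm] at hp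
    omega

lemma dist_le_dist_succ {x y z : V} (h : G.Reachable x y) (hyz : G.Adj y z) :
    G.dist x z ≤ G.dist x y + 1 := by
  obtain ⟨q', hq'⟩ := h.exists_walk_length_eq_dist
  have := SimpleGraph.dist_le (q'.concat hyz)
  rw [SimpleGraph.Walk.length_concat] at this
  omega

end Distance

/-! ### What the equilibrium condition says about a single deviation. -/

section Deviation

variable {V : Type*} [Fintype V] [DecidableEq V] {α : ℝ} {s : Profile V}

lemma sum_edist_eq (G : SimpleGraph V) (x : V) :
    ∑ v ∈ Finset.univ.erase x, ((G.edist x v : ℕ∞) : ℝ≥0∞) = ∑ v, ((G.edist x v : ℕ∞) : ℝ≥0∞) := by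
  rw [← Finset.add_sum_erase _ _ (Finset.mem_univ x)]
  simp

/-- Linking to everybody has finite cost, so the equilibrium cost is finite too. -/
lemma IsNashEquilibrium.connected [Nonempty V] (hs : IsNashEquilibrium α s) :
    (network s).Connected := by
  rw [SimpleGraph.connected_iff]
  refine ⟨fun x z => ?_, inferInstance⟩
  let t : Strategy x := ⟨Finset.univ.erase x, by simp⟩
  have h := hs x t
  have hadj : ∀ v, v ≠ x → (network (Function.update s x t)).Adj x v := by
    intro v hv
    left
    rw [Function.update_self]
    simp [t, hv]
  have hfin : cost α (Function.update s x t) x ≠ ⊤ := by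
    unfold cost
    refine ENNReal.add_ne_top.2 ⟨ENNReal.mul_ne_top ENNReal.ofReal_ne_top (by simp), ?_⟩
    refine ENNReal.sum_ne_top.2 fun v hv => ?_
    have := (SimpleGraph.edist_eq_one_iff_adj.2 (hadj v (Finset.ne_of_mem_erase hv)))
    rw [this]; simp
  have hfin' : cost α s x ≠ ⊤ := ne_top_of_le_ne_top hfin h
  unfold cost at hfin'
  rw [sum_edist_eq] at hfin'
  have := ENNReal.sum_ne_top.1 (ENNReal.add_ne_top.1 hfin').2 z (Finset.mem_univ z)
  exact SimpleGraph.edist_ne_top_iff_reachable.1 (by simpa using this)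

/-- Player `x` exchanges the links `R` for the links `A`. Quantifying over every `G'` that keeps the
untouched edges avoids describing the new network exactly: a dropped link may survive if its other
end bought it as well, and this only helps. -/
theorem IsNashEquilibrium.deviation (hs : IsNashEquilibrium α s) (hα : 0 ≤ α)
    (hG : (network s).Connected) (x : V) (R A : Finset V) (hR : R ⊆ (s x).1) (hA : x ∉ A)
    (g : V → ℕ)
    (hg : ∀ G' : SimpleGraph V,
      (∀ a b, (network s).Adj a b → (a = x → b ∉ R) → (b = x → a ∉ R) → G'.Adj a b) →
      (∀ y ∈ A, G'.Adj x y) → ∀ z, G'.edist x z ≤ g z) :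
    α * R.card + ∑ z, ((network s).dist x z : ℝ) ≤ α * A.card + ∑ z, (g z : ℝ) := by
  let t : Strategy x := ⟨((s x).1 \ R) ∪ A, by
    have := (s x).2
    simp [this, hA]⟩
  have h := hs x t
  have hdist := hg (network (Function.update s x t)) (by
    intro a b hab ha hb
    by_cases hax : a = x
    · subst hax
      rcases hab with hab | hab
      · left; rw [Function.update_self]; simp [t, hab, ha rfl]
      · right
        have : b ≠ a := fun h => by subst h; exact (s b).2 hab
        rw [Function.update_of_ne this]; exact hab
    · by_cases hbx : b = x
      · subst hbx
        rcases hab with hab | hab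
        · left; rw [Function.update_of_ne hax]; exact hab
        · right; rw [Function.update_self]; simp [t, hab, hb rfl]
      · rcases hab with hab | hab
        · left; rw [Function.update_of_ne hax]; exact hab
        · right; rw [Function.update_of_ne hbx]; exact hab) (by
    intro y hy
    left; rw [Function.update_self]; simp [t, hy])
  have hL : cost α s x = ENNReal.ofReal (α * (s x).1.card + ∑ z, ((network s).dist x z : ℝ)) := by
    unfold cost
    rw [sum_edist_eq, ENNReal.ofReal_add (by positivity) (by positivity),
      ENNReal.ofReal_mul hα, ENNReal.ofReal_natCast,
      ENNReal.ofReal_sum_of_nonneg (by intros; positivity)]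
    congr 1
    refine Finset.sum_congr rfl fun z _ => ?_
    rw [← (hG.preconnected x z).coe_dist_eq_edist, ENNReal.ofReal_natCast]
    simp
  have hU : cost α (Function.update s x t) x ≤
      ENNReal.ofReal (α * (t.1.card : ℝ) + ∑ z, (g z : ℝ)) := by
    unfold cost
    rw [sum_edist_eq, ENNReal.ofReal_add (by positivity) (by positivity),
      ENNReal.ofReal_mul hα, ENNReal.ofReal_natCast,
      ENNReal.ofReal_sum_of_nonneg (by intros; positivity), Function.update_self]
    gcongr with z
    rw [ENNReal.ofReal_natCast]
    have := hdist z
    calc _ ≤ (((g z : ℕ) : ℕ∞) : ℝ≥0∞) := by exact_mod_cast this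
      _ = _ := by simp
  have h1 := hL ▸ h.trans hU
  rw [ENNReal.ofReal_le_ofReal_iff (by positivity)] at h1
  have hc : (t.1.card : ℝ) + R.card ≤ (s x).1.card + A.card := by
    have h2 := Finset.card_union_le ((s x).1 \ R) A
    have h3 := Finset.card_sdiff_add_card_eq_card hR
    have : t.1.card = (((s x).1 \ R) ∪ A).card := rfl
    exact_mod_cast (by omega : t.1.card + R.card ≤ (s x).1.card + A.card)
  nlinarith [mul_le_mul_of_nonneg_left hc hα]

end Deviation

/-- The real number `1` or `0` according to whether a proposition holds. -/
noncomputable def ind (p : Prop) : ℝ := by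
  classical exact if p then 1 else 0

lemma ind_of {p : Prop} (h : p) : ind p = 1 := if_pos h

lemma ind_of_not {p : Prop} (h : ¬ p) : ind p = 0 := if_neg h

lemma ind_nonneg (p : Prop) : 0 ≤ ind p := by
  by_cases h : p
  · rw [ind_of h]; norm_num
  · rw [ind_of_not h]

/-! ### Distances when `x` is joined to the rest through two edges. -/

section Cut

variable {V : Type*} {G : SimpleGraph V}

/-- The graph obtained by deleting the edges from `x` to `a` and `b`. -/
def cutAt (G : SimpleGraph V) (x a b : V) : SimpleGraph V :=
  G.deleteEdges {s(x, a), s(x, b)}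

lemma cutAt_comm (G : SimpleGraph V) (x a b : V) : cutAt G x a b = cutAt G x b a := by
  unfold cutAt; rw [Set.pair_comm]

lemma cutAt_adj {x a b c d : V} : (cutAt G x a b).Adj c d ↔
    G.Adj c d ∧ (c = x → d ≠ a ∧ d ≠ b) ∧ (d = x → c ≠ a ∧ c ≠ b) := by
  unfold cutAt
  simp only [SimpleGraph.deleteEdges_adj, Set.mem_insert_iff, Set.mem_singleton_iff, Sym2.eq_iff]
  constructor
  · rintro ⟨h, h'⟩
    refine ⟨h, ?_, ?_⟩ <;> rintro rfl <;> tauto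
  · rintro ⟨h, h1, h2⟩
    refine ⟨h, ?_⟩
    rintro ((⟨rfl, rfl⟩ | ⟨rfl, rfl⟩) | (⟨rfl, rfl⟩ | ⟨rfl, rfl⟩)) <;> simp_all

lemma cutAt_le (x a b : V) : cutAt G x a b ≤ G := fun _ _ h => (cutAt_adj.1 h).1

lemma adj_cutAt_or {x a b c d : V} (h : G.Adj c d) : (cutAt G x a b).Adj c d ∨
    (c = x ∧ (d = a ∨ d = b)) ∨ (d = x ∧ (c = a ∨ c = b)) := by
  rw [cutAt_adj]; tauto

variable {x a b : V}

lemma cutAt_reachable_or (hG : G.Connected) (hab : (cutAt G x a b).Reachable a b) (z : V) :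
    (cutAt G x a b).Reachable x z ∨ (cutAt G x a b).Reachable a z := by
  have key : ∀ {y z : V} (p : G.Walk y z),
      ((cutAt G x a b).Reachable x y ∨ (cutAt G x a b).Reachable a y) →
      ((cutAt G x a b).Reachable x z ∨ (cutAt G x a b).Reachable a z) := by
    intro y z p
    induction p with
    | nil => exact id
    | cons h p ih =>
      intro hy
      apply ih
      rcases adj_cutAt_or (x := x) (a := a) (b := b) h with h | ⟨rfl, rfl | rfl⟩ | ⟨rfl, rfl | rfl⟩
      · exact hy.imp (fun h' => h'.trans h.reachable) (fun h' => h'.trans h.reachable)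
      · exact Or.inr (SimpleGraph.Reachable.refl _)
      · exact Or.inr hab
      · exact Or.inl (SimpleGraph.Reachable.refl _)
      · exact Or.inl (SimpleGraph.Reachable.refl _)
  obtain ⟨p⟩ := hG.preconnected x z
  exact key p (Or.inl (SimpleGraph.Reachable.refl _))

open Classical in
/-- A lower bound for the distance from a vertex on the side of `a` and `b`. -/
noncomputable def cutBound (G : SimpleGraph V) (x a b y z : V) : ℕ :=
  if (cutAt G x a b).Reachable x z then
    1 + min ((cutAt G x a b).dist a y) ((cutAt G x a b).dist b y) + (cutAt G x a b).dist x z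
  else min ((cutAt G x a b).dist y z)
    (min ((cutAt G x a b).dist a y + 2 + (cutAt G x a b).dist b z)
      ((cutAt G x a b).dist b y + 2 + (cutAt G x a b).dist a z))

/-- A path from `y` can reach the side of `x` only through `a` or `b`. A path returning to its own
side either stays there or makes the detour `a`, `x`, `b` of length two, in one of the two
directions. Formally, `cutBound` vanishes at `y` and is 1-Lipschitz. -/
lemma cutBound_le (hG : G.Connected) (hab : (cutAt G x a b).Reachable a b)
    (hxa : ¬ (cutAt G x a b).Reachable x a) {y : V} (hy : (cutAt G x a b).Reachable a y) (z : V) :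
    cutBound G x a b y z ≤ G.dist y z := by
  set H := cutAt G x a b with hH
  have hxb : ¬ H.Reachable x b := fun h => hxa (h.trans hab.symm)
  have hout : ∀ z, H.Reachable a z → ¬ H.Reachable x z := fun z h h' => hxa (h'.trans h.symm)
  have hX : ∀ z, H.Reachable x z →
      cutBound G x a b y z = 1 + min (H.dist a y) (H.dist b y) + H.dist x z := by
    intro z hz; unfold cutBound; rw [if_pos hz]
  have hO : ∀ z, ¬ H.Reachable x z → cutBound G x a b y z =
      min (H.dist y z) (min (H.dist a y + 2 + H.dist b z) (H.dist b y + 2 + H.dist a z)) := by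
    intro z hz; unfold cutBound; rw [if_neg hz]
  have hx := SimpleGraph.Reachable.refl (G := H) x
  refine le_dist_of_lipschitz hG (cutBound G x a b y) ?_ ?_ z
  · intro c d hcd
    rcases adj_cutAt_or (x := x) (a := a) (b := b) hcd with h | ⟨rfl, rfl | rfl⟩ | ⟨rfl, rfl | rfl⟩
    · rw [← hH] at h
      by_cases hc : H.Reachable x c
      · rw [hX c hc, hX d (hc.trans h.reachable)]
        have := dist_le_dist_succ hc h
        omega
      · have hd : ¬ H.Reachable x d := fun h' => hc (h'.trans h.symm.reachable)
        have hac : H.Reachable a c := (cutAt_reachable_or hG hab c).resolve_left hc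
        rw [hO c hc, hO d hd]
        have h1 := dist_le_dist_succ (hy.symm.trans hac) h
        have h2 := dist_le_dist_succ hac h
        have h3 := dist_le_dist_succ (hab.symm.trans hac) h
        omega
    · rw [hX c hx, hO d hxa]
      have : H.dist d d = 0 := by simp
      rw [SimpleGraph.dist_comm (u := y), this, SimpleGraph.dist_self]
      omega
    · rw [hX c hx, hO d hxb]
      rw [SimpleGraph.dist_comm (u := y), SimpleGraph.dist_self, SimpleGraph.dist_self]
      omega
    · rw [hX d hx, hO c hxa]
      rw [SimpleGraph.dist_comm (u := y), SimpleGraph.dist_self, SimpleGraph.dist_self]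
      omega
    · rw [hX d hx, hO c hxb]
      rw [SimpleGraph.dist_comm (u := y), SimpleGraph.dist_self, SimpleGraph.dist_self]
      omega
  · rw [hO y (hout y hy), SimpleGraph.dist_self]; simp

lemma cutAt_dist_le_of_reachable (hG : G.Connected) (hab : (cutAt G x a b).Reachable a b)
    (hxa : ¬ (cutAt G x a b).Reachable x a) {y z : V} (hy : (cutAt G x a b).Reachable a y)
    (hz : (cutAt G x a b).Reachable x z) :
    1 + min ((cutAt G x a b).dist a y) ((cutAt G x a b).dist b y) + (cutAt G x a b).dist x z ≤
      G.dist y z := by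
  have h := cutBound_le hG hab hxa hy z
  unfold cutBound at h
  rwa [if_pos hz] at h

lemma cutAt_dist_le_of_not_reachable (hG : G.Connected) (hab : (cutAt G x a b).Reachable a b)
    (hxa : ¬ (cutAt G x a b).Reachable x a) {y z : V} (hy : (cutAt G x a b).Reachable a y)
    (hz : ¬ (cutAt G x a b).Reachable x z) :
    min ((cutAt G x a b).dist y z) (min ((cutAt G x a b).dist a y + 2 + (cutAt G x a b).dist b z)
      ((cutAt G x a b).dist b y + 2 + (cutAt G x a b).dist a z)) ≤ G.dist y z := by
  have h := cutBound_le hG hab hxa hy z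
  unfold cutBound at h
  rwa [if_neg hz] at h

lemma exists_on_geodesic {H : SimpleGraph V} (hab : H.Reachable a b) (k : ℕ) :
    ∀ i, i + k = H.dist a b → ∃ v, H.Reachable a v ∧ H.dist a v = i ∧ H.dist b v = k := by
  induction k with
  | zero => intro i hi; exact ⟨b, hab, by omega, by simp⟩
  | succ k ih =>
    intro i hi
    obtain ⟨v, hv, hav, hbv⟩ := ih (i + 1) (by omega)
    have hne : v ≠ a := by rintro rfl; simp at hav
    obtain ⟨y, hyv, hy, hd⟩ := exists_adj_dist_succ hv hne
    refine ⟨y, hy, by omega, ?_⟩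
    have h1 := dist_le_dist_succ (hab.symm.trans hv) hyv.symm
    have h2 := hy.dist_triangle_left b
    rw [SimpleGraph.dist_comm (u := y)] at h2
    omega

lemma exists_edge_on_geodesic {H : SimpleGraph V} (hab : H.Reachable a b) {i k : ℕ}
    (h : i + k + 1 = H.dist a b) : ∃ v w, H.Adj v w ∧ H.Reachable a v ∧
      H.dist a v = i ∧ H.dist b v = k + 1 ∧ H.dist a w = i + 1 ∧ H.dist b w = k := by
  obtain ⟨v, hv, hav, hbv⟩ := exists_on_geodesic hab k (i + 1) (by omega)
  have hne : v ≠ a := by rintro rfl; simp at hav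
  obtain ⟨y, hyv, hy, hd⟩ := exists_adj_dist_succ hv hne
  refine ⟨y, v, hyv, hy, by omega, ?_, hav, hbv⟩
  have h1 := dist_le_dist_succ (hab.symm.trans hv) hyv.symm
  have h2 := hy.dist_triangle_left b
  rw [SimpleGraph.dist_comm (u := y)] at h2
  omega

end Cut

/-! ### A vertex attached through two edges buys neither of them. -/

section DegreeTwo

variable {V : Type*} [Fintype V] [DecidableEq V] {α : ℝ} {s : Profile V}

/-- The edge from `u` to `u'` lies opposite to `x` on a cycle through `a` and `b`. Two deviations
are added: `x` exchanges `R` for a link to `u`, and `u` exchanges `u'` for a link to `x`. The total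
distances of `x` and `u` cancel, except that the vertices on the side of `x` are no longer charged
the half cycle separating them from `u`. The slack in `hjk` and `hkj` lets either endpoint of a
middle edge play `u`. -/
lemma antipodal_exchange_aux (hs : IsNashEquilibrium α s) (hα : 0 ≤ α)
    (hG : (network s).Connected) {x a b : V}
    (hxb : (network s).Adj x b)
    (hab : (cutAt (network s) x a b).Reachable a b)
    (hxa : ¬ (cutAt (network s) x a b).Reachable x a)
    {R : Finset V} (hR : R ⊆ (s x).1) (hRab : R ⊆ {a, b}) {u u' : V} {j k : ℕ}
    (hu' : u' ∈ (s u).1) (hau : (cutAt (network s) x a b).Reachable a u)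
    (huu' : (cutAt (network s) x a b).Adj u u')
    (h1 : (cutAt (network s) x a b).dist a u = j) (h2 : (cutAt (network s) x a b).dist b u = k + 1)
    (h3 : (cutAt (network s) x a b).dist a u' = j + 1) (h4 : (cutAt (network s) x a b).dist b u' = k)
    (hjk : j ≤ k + 3) (hkj : k ≤ j + 1) (hl : j + k + 1 = (cutAt (network s) x a b).dist a b) :
    α * R.card + (((cutAt (network s) x a b).dist a b : ℝ) / 2 + 1) *
      ∑ z, ind ((cutAt (network s) x a b).Reachable x z) ≤ α + 2 * Fintype.card V := by
  classical
  set G := network s with hGdef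
  set H := cutAt G x a b with hH
  have hxu : u ≠ x := by rintro rfl; exact hxa hau.symm
  have hau' : H.Reachable a u' := hau.trans huu'.reachable
  have hxu' : u' ≠ x := by rintro rfl; exact hxa hau'.symm
  set g : V → ℕ := fun z => if H.Reachable x z then H.dist x z else 1 + G.dist u z with hg
  have dev1 := hs.deviation hα hG x R {u} hR (by simp [hxu.symm]) g (by
    intro G' hG' hA z
    have hle : H ≤ G' := by
      intro c d hcd
      obtain ⟨hcd, hc, hd⟩ := cutAt_adj.1 hcd
      refine hG' c d hcd ?_ ?_
      · rintro rfl hdR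
        have := hRab hdR
        simp only [Finset.mem_insert, Finset.mem_singleton] at this
        have := hc rfl; tauto
      · rintro rfl hdR
        have := hRab hdR
        simp only [Finset.mem_insert, Finset.mem_singleton] at this
        have := hd rfl; tauto
    by_cases hz : H.Reachable x z
    · have : g z = H.dist x z := if_pos hz
      rw [this, hz.coe_dist_eq_edist]
      exact SimpleGraph.edist_anti hle
    · have : g z = 1 + G.dist u z := if_neg hz
      rw [this]
      have haz : H.Reachable a z := (cutAt_reachable_or hG hab z).resolve_left hz
      have hlow := cutAt_dist_le_of_not_reachable hG hab hxa hau hz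
      rw [← hH] at hlow
      have t1 : H.dist u z ≤ H.dist u b + H.dist b z :=
        (hau.symm.trans hab).dist_triangle_left z
      have t2 : H.dist u z ≤ H.dist u a + H.dist a z := hau.symm.dist_triangle_left z
      rw [SimpleGraph.dist_comm (u := u) (v := b)] at t1
      rw [SimpleGraph.dist_comm (u := u) (v := a)] at t2
      have hud : H.dist u z ≤ G.dist u z := by omega
      have huz : G'.edist u z ≤ (H.dist u z : ℕ) := by
        rw [(hau.symm.trans haz).coe_dist_eq_edist]
        exact SimpleGraph.edist_anti hle
      calc G'.edist x z ≤ G'.edist x u + G'.edist u z := SimpleGraph.edist_triangle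
        _ ≤ ((1 : ℕ) : ℕ∞) + (H.dist u z : ℕ) :=
          add_le_add (edist_le_of_adj (hA u (by simp)) le_rfl) huz
        _ ≤ ((1 + G.dist u z : ℕ) : ℕ∞) := by exact_mod_cast (by omega))
  have hxb' : G.dist x b ≤ 1 := by
    have := SimpleGraph.dist_eq_one_iff_adj.2 hxb; omega
  have hdxu : 1 + min j (k + 1) ≤ G.dist x u := by
    have := cutAt_dist_le_of_reachable hG hab hxa hau (SimpleGraph.Reachable.refl x)
    rw [← hH, h1, h2, SimpleGraph.dist_self, SimpleGraph.dist_comm] at this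
    omega
  have dev2 := hs.deviation hα hG u {u'} {x} (by simpa using hu') (by simpa using hxu)
    (fun z => 1 + G.dist x z) (by
    intro G' hG' hA
    have hux : G'.Adj u x := hA x (by simp)
    have hkeep : ∀ c d, G.Adj c d → ¬ (c = u ∧ d = u') → ¬ (c = u' ∧ d = u) → G'.Adj c d := by
      intro c d hcd h h'
      refine hG' c d hcd ?_ ?_
      · rintro rfl; simpa using fun e => h ⟨rfl, e⟩
      · rintro rfl; simpa using fun e => h' ⟨e, rfl⟩
    -- Without its edge to `u'`, the player `u` still reaches `u'` by going through `x` and `b`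
    -- around the other half of the cycle.
    have hB : ∀ z, H.Reachable a z ∧ H.dist b z ≤ k → G'.edist u z ≤ (2 + H.dist b z : ℕ) := by
      refine edist_le_of_descent {z | H.Reachable a z ∧ H.dist b z ≤ k}
        (fun z => 2 + H.dist b z) ?_
      rintro z ⟨haz, hbz⟩
      by_cases hzb : z = b
      · left
        rw [hzb, SimpleGraph.dist_self]
        refine edist_le_succ_of_adj (y := x) (hkeep _ _ hxb ?_ ?_)
          (edist_le_of_adj hux le_rfl)
        · rintro ⟨rfl, -⟩; exact hxu rfl
        · rintro ⟨rfl, -⟩; exact hxu' rfl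
      · right
        obtain ⟨y, hyz, hby, hd⟩ := exists_adj_dist_succ (hab.symm.trans haz) hzb
        refine ⟨y, ⟨hab.trans hby, by omega⟩, hkeep _ _ (cutAt_le _ _ _ hyz) ?_ ?_, by omega⟩
        · rintro ⟨rfl, -⟩; omega
        · rintro ⟨-, rfl⟩; omega
    intro z
    refine edist_le_of_descent Set.univ (fun z => 1 + G.dist x z) ?_ z trivial
    intro z _
    by_cases hzx : z = x
    · left; rw [hzx]; exact edist_le_of_adj hux (by omega)
    by_cases hzu : z = u
    · left; rw [hzu]; exact edist_self_le
    obtain ⟨y, hyz, -, hd⟩ := exists_adj_dist_succ (hG.preconnected x z) hzx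
    by_cases hy : y = u ∧ z = u'
    · left
      obtain ⟨rfl, rfl⟩ := hy
      refine edist_le_of_le (hB z ⟨hau', by omega⟩) ?_
      omega
    · right
      refine ⟨y, trivial, hkeep _ _ hyz hy ?_, by omega⟩
      rintro ⟨-, rfl⟩; exact hzu rfl)
  have hpt : ∀ z, (g z : ℝ) + ((H.dist a b : ℝ) / 2 + 1) * ind (H.Reachable x z) ≤
      1 + G.dist u z := by
    intro z
    by_cases hz : H.Reachable x z
    · have : g z = H.dist x z := if_pos hz
      rw [this, ind_of hz]
      have h := cutAt_dist_le_of_reachable hG hab hxa hau hz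
      rw [← hH, h1, h2] at h
      have h' : 2 * H.dist x z + H.dist a b ≤ 2 * G.dist u z := by omega
      have h'' : (2 * H.dist x z + H.dist a b : ℝ) ≤ 2 * G.dist u z := by exact_mod_cast h'
      linarith
    · have : g z = 1 + G.dist u z := if_neg hz
      rw [this, ind_of_not hz]
      push_cast; linarith
  have hsum := Finset.sum_le_sum fun z (_ : z ∈ Finset.univ) => hpt z
  rw [Finset.sum_add_distrib, Finset.sum_add_distrib, ← Finset.mul_sum] at hsum
  push_cast [Finset.sum_add_distrib] at dev1 dev2
  simp only [Finset.sum_const, Finset.card_univ, nsmul_eq_mul, mul_one, Finset.card_singleton,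
    Nat.cast_one] at dev1 dev2 hsum
  linarith

lemma antipodal_exchange (hs : IsNashEquilibrium α s) (hα : 0 ≤ α)
    (hG : (network s).Connected) {x a b : V} (hne : a ≠ b)
    (hAa : (network s).Adj x a) (hAb : (network s).Adj x b)
    (hab : (cutAt (network s) x a b).Reachable a b)
    (hxa : ¬ (cutAt (network s) x a b).Reachable x a)
    {R : Finset V} (hR : R ⊆ (s x).1) (hRab : R ⊆ {a, b}) :
    α * R.card + (((cutAt (network s) x a b).dist a b : ℝ) / 2 + 1) *
      ∑ z, ind ((cutAt (network s) x a b).Reachable x z) ≤ α + 2 * Fintype.card V := by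
  have hpos := hab.pos_dist_of_ne hne
  obtain ⟨i, k, hik, h1, h2⟩ : ∃ i k, i + k + 1 = (cutAt (network s) x a b).dist a b ∧
      i ≤ k + 1 ∧ k ≤ i := by
    refine ⟨(cutAt (network s) x a b).dist a b / 2,
      (cutAt (network s) x a b).dist a b - 1 - (cutAt (network s) x a b).dist a b / 2, ?_, ?_, ?_⟩
      <;> omega
  obtain ⟨v, w, hvw, hav, d1, d2, d3, d4⟩ := exists_edge_on_geodesic hab hik
  rcases cutAt_le _ _ _ hvw with ho | ho
  · exact antipodal_exchange_aux hs hα hG hAb hab hxa hR hRab ho hav hvw d1 d2 d3 d4 (by omega)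
      (by omega) hik
  · have hxb : ¬ (cutAt (network s) x a b).Reachable x b := fun h => hxa (h.trans hab.symm)
    have hbw : (cutAt (network s) x a b).Reachable b w :=
      hab.symm.trans (hav.trans hvw.reachable)
    rw [SimpleGraph.dist_comm]
    rw [SimpleGraph.dist_comm] at hik
    have hab' := hab.symm
    have hvw' := hvw.symm
    rw [cutAt_comm] at *
    exact antipodal_exchange_aux hs hα hG hAa hab' hxb hR (by rwa [Finset.pair_comm]) ho hbw hvw'
      d4 d3 d2 d1 (by omega) (by omega) (by omega)

/-- If `x` bought both edges, trading them for one would give `α ≤ 2n`. If `b` bought the other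
edge, let `t` be the size of the side of `x` and `l` the length from `a` to `b` avoiding that side.
The exchange gives `(l/2 + 1)t ≤ 2n`, while two deviations of `b` give `α ≤ 2lt`, so `α ≤ 8n - 4t <
8n`. -/
theorem not_owner_of_cut_pair (hs : IsNashEquilibrium α s) (hα : 8 * (Fintype.card V : ℝ) ≤ α)
    (hG : (network s).Connected) {x a b : V} (hne : a ≠ b)
    (hAb : (network s).Adj x b)
    (hab : (cutAt (network s) x a b).Reachable a b)
    (hxa : ¬ (cutAt (network s) x a b).Reachable x a) : a ∉ (s x).1 := by
  classical
  intro ha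
  have hα0 : 0 ≤ α := le_trans (by positivity) hα
  have hAa : (network s).Adj x a := Or.inl ha
  have hn : (1 : ℝ) ≤ Fintype.card V := by
    have : 0 < Fintype.card V := Fintype.card_pos_iff.2 ⟨x⟩
    exact_mod_cast this
  set t := ∑ z, ind ((cutAt (network s) x a b).Reachable x z) with ht
  have ht0 : 1 ≤ t := by
    rw [ht, ← ind_of (SimpleGraph.Reachable.refl (G := cutAt (network s) x a b) x)]
    exact Finset.single_le_sum (f := fun z => ind ((cutAt (network s) x a b).Reachable x z))
      (fun z _ => ind_nonneg _) (Finset.mem_univ x)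
  rcases hAb with hb | hb
  · have h := antipodal_exchange hs hα0 hG hne hAa (Or.inl hb) hab hxa (R := {a, b})
      (by intro v; simp only [Finset.mem_insert, Finset.mem_singleton]; rintro (rfl | rfl) <;> assumption)
      subset_rfl
    rw [Finset.card_pair hne, ← ht] at h
    have : 0 ≤ (((cutAt (network s) x a b).dist a b : ℝ) / 2 + 1) * t := by positivity
    push_cast at h
    linarith
  · have hAb : (network s).Adj x b := Or.inr hb
    have h := antipodal_exchange hs hα0 hG hne hAa hAb hab hxa (R := {a})
      (by simpa using ha) (by simp)
    rw [Finset.card_singleton, ← ht] at h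
    set G := network s with hGdef
    set H := cutAt G x a b with hH
    have hxb : ¬ H.Reachable x b := fun h => hxa (h.trans hab.symm)
    have hbx : b ≠ x := hAb.ne'
    have hax : a ≠ x := hAa.ne'
    set l := H.dist a b with hl
    have lowX : ∀ z, H.Reachable x z → 1 + H.dist x z ≤ G.dist b z := by
      intro z hz
      have := cutAt_dist_le_of_reachable hG hab hxa hab hz
      rw [← hH, SimpleGraph.dist_self] at this
      omega
    have lowO : ∀ z, ¬ H.Reachable x z →
        min (H.dist b z) (2 + H.dist a z) ≤ G.dist b z := by
      intro z hz
      have := cutAt_dist_le_of_not_reachable hG hab hxa hab hz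
      rw [← hH, SimpleGraph.dist_self] at this
      omega
    have hout : ∀ z, ¬ H.Reachable x z → H.Reachable a z := fun z hz =>
      (cutAt_reachable_or hG hab z).resolve_left hz
    have hkeepH : ∀ G' : SimpleGraph V, (∀ c d, G.Adj c d → (c = b → d ∉ ({x} : Finset V)) →
        (d = b → c ∉ ({x} : Finset V)) → G'.Adj c d) → H ≤ G' := by
      intro G' hG' c d hcd
      obtain ⟨hcd, h1, h2⟩ := cutAt_adj.1 hcd
      refine hG' c d hcd ?_ ?_
      · rintro rfl; simp only [Finset.mem_singleton]; exact fun e => (h2 e).2 rfl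
      · rintro rfl; simp only [Finset.mem_singleton]; exact fun e => (h1 e).2 rfl
    have hkeepA : ∀ G' : SimpleGraph V, (∀ c d, G.Adj c d → (c = b → d ∉ ({x} : Finset V)) →
        (d = b → c ∉ ({x} : Finset V)) → G'.Adj c d) → G'.Adj a x := by
      intro G' hG'
      exact hG' a x hAa.symm (fun h => absurd h hne) (fun h => absurd h.symm hbx)
    have edH : ∀ G' : SimpleGraph V, H ≤ G' → ∀ y z, H.Reachable y z →
        G'.edist y z ≤ (H.dist y z : ℕ) := by
      intro G' hle y z hyz
      rw [hyz.coe_dist_eq_edist]; exact SimpleGraph.edist_anti hle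
    have hedX : ∀ G' : SimpleGraph V, H ≤ G' → G'.Adj a x → ∀ m : ℕ, G'.edist b a ≤ m →
        ∀ z, H.Reachable x z → G'.edist b z ≤ (m + 1 + H.dist x z : ℕ) := by
      intro G' hle hax' m hm z hz
      calc G'.edist b z ≤ G'.edist b x + G'.edist x z := SimpleGraph.edist_triangle
        _ ≤ ((m + 1 : ℕ) : ℕ∞) + (H.dist x z : ℕ) :=
          add_le_add (edist_le_succ_of_adj hax' hm) (edH G' hle x z hz)
        _ = _ := by push_cast; rfl
    set g3 : V → ℕ := fun z => if H.Reachable x z then 1 + 1 + H.dist x z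
      else min (H.dist b z) (1 + H.dist a z) with hg3
    set g4 : V → ℕ := fun z => if H.Reachable x z then l + 1 + H.dist x z
      else H.dist b z with hg4
    -- Moving the link of `b` from `x` to `a` costs at most one step for each vertex on the side of
    -- `x`, and gains at least one for each vertex counted by `I`.
    have dev3 := hs.deviation hα0 hG b {x} {a} (by simpa using hb) (by simpa using hne.symm) g3 (by
      intro G' hG' hA z
      have hle := hkeepH G' hG'
      have hba : G'.edist b a ≤ (1 : ℕ) := edist_le_of_adj (hA a (by simp)) le_rfl
      by_cases hz : H.Reachable x z
      · have : g3 z = 1 + 1 + H.dist x z := if_pos hz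
        rw [this]
        exact hedX G' hle (hkeepA G' hG') 1 hba z hz
      · have : g3 z = min (H.dist b z) (1 + H.dist a z) := if_neg hz
        rw [this]
        rcases min_choice (H.dist b z) (1 + H.dist a z) with h | h <;> rw [h]
        · exact edH G' hle b z (hab.symm.trans (hout z hz))
        · calc G'.edist b z ≤ G'.edist b a + G'.edist a z := SimpleGraph.edist_triangle
            _ ≤ ((1 : ℕ) : ℕ∞) + (H.dist a z : ℕ) := add_le_add hba (edH G' hle a z (hout z hz))
            _ = _ := by push_cast; rfl)
    -- Dropping the link harms only the side of `x` and the vertices counted by `I`, each by at most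
    -- `l`.
    have dev4 := hs.deviation hα0 hG b {x} ∅ (by simpa using hb) (by simp) g4 (by
      intro G' hG' hA z
      have hle := hkeepH G' hG'
      by_cases hz : H.Reachable x z
      · have : g4 z = l + 1 + H.dist x z := if_pos hz
        rw [this]
        refine hedX G' hle (hkeepA G' hG') l ?_ z hz
        rw [hl, SimpleGraph.dist_comm]
        exact edH G' hle b a hab.symm
      · have : g4 z = H.dist b z := if_neg hz
        rw [this]
        exact edH G' hle b z (hab.symm.trans (hout z hz)))
    set I : V → ℝ := fun z => ind (¬ H.Reachable x z ∧ H.dist a z + 2 ≤ H.dist b z) with hI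
    have pt3 : ∀ z, (g3 z : ℝ) + I z ≤ G.dist b z + ind (H.Reachable x z) := by
      intro z
      by_cases hz : H.Reachable x z
      · have e1 : g3 z = 1 + 1 + H.dist x z := if_pos hz
        have e2 : I z = 0 := ind_of_not fun h => h.1 hz
        rw [e1, e2, ind_of hz]
        exact_mod_cast (by have := lowX z hz; omega : 1 + 1 + H.dist x z + 0 ≤ G.dist b z + 1)
      · have e1 : g3 z = min (H.dist b z) (1 + H.dist a z) := if_neg hz
        have hlow := lowO z hz
        rw [e1, ind_of_not hz]
        by_cases h' : H.dist a z + 2 ≤ H.dist b z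
        · have e2 : I z = 1 := ind_of ⟨hz, h'⟩
          rw [e2]
          exact_mod_cast (by omega : min (H.dist b z) (1 + H.dist a z) + 1 ≤ G.dist b z + 0)
        · have e2 : I z = 0 := ind_of_not fun h => h' h.2
          rw [e2]
          exact_mod_cast (by omega : min (H.dist b z) (1 + H.dist a z) + 0 ≤ G.dist b z + 0)
    have pt4 : ∀ z, (g4 z : ℝ) ≤ G.dist b z + l * (ind (H.Reachable x z) + I z) := by
      intro z
      by_cases hz : H.Reachable x z
      · have e1 : g4 z = l + 1 + H.dist x z := if_pos hz
        have e2 : I z = 0 := ind_of_not fun h => h.1 hz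
        rw [e1, e2, ind_of hz]
        have : l + 1 + H.dist x z ≤ G.dist b z + l := by have := lowX z hz; omega
        have : ((l + 1 + H.dist x z : ℕ) : ℝ) ≤ G.dist b z + l := by exact_mod_cast this
        linarith
      · have e1 : g4 z = H.dist b z := if_neg hz
        have hlow := lowO z hz
        have htri : H.dist b z ≤ H.dist b a + H.dist a z := hab.symm.dist_triangle_left z
        rw [SimpleGraph.dist_comm (u := b) (v := a), ← hl] at htri
        rw [e1, ind_of_not hz]
        by_cases h' : H.dist a z + 2 ≤ H.dist b z
        · have e2 : I z = 1 := ind_of ⟨hz, h'⟩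
          rw [e2]
          have : H.dist b z ≤ G.dist b z + l := by omega
          have : (H.dist b z : ℝ) ≤ G.dist b z + l := by exact_mod_cast this
          linarith
        · have e2 : I z = 0 := ind_of_not fun h => h' h.2
          rw [e2]
          have : H.dist b z ≤ G.dist b z := by omega
          have : (H.dist b z : ℝ) ≤ G.dist b z := by exact_mod_cast this
          linarith
    have s3 := Finset.sum_le_sum fun z (_ : z ∈ Finset.univ) => pt3 z
    have s4 := Finset.sum_le_sum fun z (_ : z ∈ Finset.univ) => pt4 z
    rw [Finset.sum_add_distrib, Finset.sum_add_distrib, ← ht] at s3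
    rw [Finset.sum_add_distrib, ← Finset.mul_sum, Finset.sum_add_distrib, ← ht] at s4
    simp only [Finset.card_singleton, Finset.card_empty, Nat.cast_one, Nat.cast_zero, mul_one,
      mul_zero, zero_add] at dev3 dev4 h
    have hIt : ∑ z, I z ≤ t := by linarith
    have hl0 : (0 : ℝ) ≤ l := by positivity
    have : α ≤ l * (t + t) := by
      have := mul_le_mul_of_nonneg_left (add_le_add_right hIt t) hl0
      linarith
    nlinarith

end DegreeTwo

/-! ### Edges lying on cycles. -/

section NonBridge

variable {V : Type*} {G : SimpleGraph V}

/-- The edge between `a` and `b` exists and is not a bridge. -/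
def NonBridge (G : SimpleGraph V) (a b : V) : Prop :=
  G.Adj a b ∧ (G.deleteEdges {s(a, b)}).Reachable a b

lemma NonBridge.symm {a b : V} (h : NonBridge G a b) : NonBridge G b a := by
  refine ⟨h.1.symm, ?_⟩
  rw [Sym2.eq_swap]
  exact h.2.symm

lemma adj_deleteEdges_pair {a b c d : V} (h : G.Adj c d) (h1 : ¬ (c = a ∧ d = b))
    (h2 : ¬ (c = b ∧ d = a)) : (G.deleteEdges {s(a, b)}).Adj c d := by
  rw [SimpleGraph.deleteEdges_adj]
  refine ⟨h, ?_⟩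
  rw [Set.mem_singleton_iff, Sym2.eq_iff]
  tauto

/-- Together with the edge from `x` to `a`, a path in `K` closes a cycle, and its first edge is the
one wanted. The rest of the path avoids `x`, hence survives in every `cutAt G x a b`. -/
lemma exists_nonBridge_of_reachable {K : SimpleGraph V} {x a : V} (hK : K ≤ G)
    (hr : K.Reachable x a) (hxa : G.Adj x a) (hn : ¬ K.Adj x a) :
    ∃ c, K.Adj x c ∧ NonBridge G x c ∧ ∀ b, (cutAt G x a b).Reachable c a := by
  classical
  obtain ⟨p, hp⟩ := hr.exists_isPath
  cases p with
  | nil => exact absurd hxa (G.loopless.irrefl _)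
  | cons hxc q =>
    rename_i c
    rw [SimpleGraph.Walk.cons_isPath_iff] at hp
    have hca : c ≠ a := by rintro rfl; exact hn hxc
    have hreach : ∀ b, (cutAt G x a b).Reachable c a := by
      intro b
      refine (q.transfer (cutAt G x a b) ?_).reachable
      intro e he
      induction e using Sym2.ind with
      | _ y z =>
        have hy := q.fst_mem_support_of_mem_edges he
        have hz := q.snd_mem_support_of_mem_edges he
        rw [SimpleGraph.mem_edgeSet, cutAt_adj]
        refine ⟨hK (q.adj_of_mem_edges he), ?_, ?_⟩
        · rintro rfl; exact absurd hy hp.2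
        · rintro rfl; exact absurd hz hp.2
    refine ⟨c, hxc, ⟨hK hxc, ?_⟩, hreach⟩
    have h1 : (G.deleteEdges {s(x, c)}).Reachable c a :=
      (hreach c).mono fun y z h => by
        obtain ⟨h, h1, h2⟩ := cutAt_adj.1 h
        exact adj_deleteEdges_pair h (fun e => (h1 e.1).2 e.2) (fun e => (h2 e.2).2 e.1)
    have h2 : (G.deleteEdges {s(x, c)}).Adj x a :=
      adj_deleteEdges_pair hxa (fun e => hca e.2.symm) (fun e => hxa.ne e.2.symm)
    exact h2.reachable.trans h1.symm

lemma NonBridge.exists_other {x a : V} (h : NonBridge G x a) :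
    ∃ c, c ≠ a ∧ NonBridge G x c ∧ ∀ b, (cutAt G x a b).Reachable c a := by
  obtain ⟨c, hc, hN, hr⟩ := exists_nonBridge_of_reachable (SimpleGraph.deleteEdges_le _) h.2 h.1
    (by simp)
  refine ⟨c, ?_, hN, hr⟩
  rintro rfl
  simp at hc

end NonBridge

/-! ### Vertices with exactly two non-bridge edges. -/

section DegreeTwo

variable {V : Type*} [Fintype V] [DecidableEq V] {α : ℝ} {s : Profile V}

/-- The two edges separate `x` from `a`: a path from `x` to `a` avoiding them would begin with a
third non-bridge edge. -/
theorem not_owner_of_two_nonBridge (hs : IsNashEquilibrium α s)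
    (hα : 8 * (Fintype.card V : ℝ) ≤ α) (hG : (network s).Connected) {x a b : V} (hne : a ≠ b)
    (hN : ∀ c, NonBridge (network s) x c ↔ c = a ∨ c = b) : a ∉ (s x).1 := by
  have ha := (hN a).2 (Or.inl rfl)
  have hb := (hN b).2 (Or.inr rfl)
  obtain ⟨c, hca, hc, hr⟩ := ha.exists_other
  obtain rfl := ((hN c).1 hc).resolve_left hca
  refine not_owner_of_cut_pair hs hα hG hne hb.1 (hr c).symm ?_
  intro h
  obtain ⟨d, hd, hdN, -⟩ := exists_nonBridge_of_reachable (cutAt_le _ _ _) h ha.1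
    (fun h => ((cutAt_adj.1 h).2.1 rfl).1 rfl)
  have := (cutAt_adj.1 hd).2.1 rfl
  have := (hN d).1 hdN
  tauto

end DegreeTwo

/-! ### Breadth first trees and non-tree edges. -/

section Tree

variable {V : Type*} {G : SimpleGraph V} {r : V} {π : V → V}

/-- `π` is the parent function of a breadth first search tree rooted at `r`. -/
structure IsParent (G : SimpleGraph V) (r : V) (π : V → V) : Prop where
  root : π r = r
  adj : ∀ z, z ≠ r → G.Adj (π z) z
  dist : ∀ z, z ≠ r → G.dist r (π z) + 1 = G.dist r z

lemma exists_isParent (hG : G.Connected) (r : V) : ∃ π, IsParent G r π := by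
  classical
  have h : ∀ z, ∃ y, (z = r → y = r) ∧ (z ≠ r → G.Adj y z ∧ G.dist r y + 1 = G.dist r z) := by
    intro z
    by_cases hz : z = r
    · exact ⟨r, fun _ => rfl, fun h => absurd hz h⟩
    · obtain ⟨y, h1, -, h2⟩ := exists_adj_dist_succ (hG.preconnected r z) hz
      exact ⟨y, fun h => absurd h hz, fun _ => ⟨h1, h2⟩⟩
  choose π h1 h2 using h
  exact ⟨π, h1 r rfl, fun z hz => (h2 z hz).1, fun z hz => (h2 z hz).2⟩

/-- `z` is a descendant of `y` in the tree with parent function `π`. -/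
def Desc (G : SimpleGraph V) (r : V) (π : V → V) (y z : V) : Prop :=
  ∃ j, j + G.dist r y = G.dist r z ∧ π^[j] z = y

/-- An edge of `G` outside of the tree with parent function `π`. -/
def NonTree (G : SimpleGraph V) (π : V → V) (v w : V) : Prop :=
  G.Adj v w ∧ w ≠ π v ∧ v ≠ π w

lemma NonTree.symm {v w : V} (h : NonTree G π v w) : NonTree G π w v := ⟨h.1.symm, h.2.2, h.2.1⟩

lemma Desc.refl (y : V) : Desc G r π y y := ⟨0, by simp, rfl⟩

lemma Desc.dist_le {y z : V} (h : Desc G r π y z) : G.dist r y ≤ G.dist r z := by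
  obtain ⟨j, h, -⟩ := h; omega

lemma IsParent.dist_iterate (hπ : IsParent G r π) (z : V) :
    ∀ j, j ≤ G.dist r z → G.dist r (π^[j] z) + j = G.dist r z := by
  intro j
  induction j with
  | zero => intro _; rfl
  | succ j ih =>
    intro hj
    have := ih (by omega)
    rw [Function.iterate_succ_apply']
    have hne : π^[j] z ≠ r := by
      intro h; rw [h, SimpleGraph.dist_self] at this; omega
    have := hπ.dist _ hne
    omega

lemma IsParent.desc_iterate (hπ : IsParent G r π) {z : V} {j : ℕ}
    (hj : j ≤ G.dist r z) : Desc G r π (π^[j] z) z :=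
  ⟨j, by have := hπ.dist_iterate z j hj; omega, rfl⟩

lemma IsParent.desc_root (hπ : IsParent G r π) (hG : G.Connected) (z : V) : Desc G r π r z := by
  have h := hπ.dist_iterate z _ le_rfl
  refine ⟨G.dist r z, by simp, ?_⟩
  have h0 : G.dist r (π^[G.dist r z] z) = 0 := by omega
  exact (hG.dist_eq_zero_iff.1 h0).symm

lemma IsParent.desc_of_parent (hπ : IsParent G r π) {y z : V} (hz : z ≠ r)
    (h : Desc G r π y (π z)) : Desc G r π y z := by
  obtain ⟨j, h1, h2⟩ := h
  have := hπ.dist z hz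
  exact ⟨j + 1, by omega, h2⟩

lemma Desc.ne_root {y z : V} (h : Desc G r π y z) (hne : z ≠ y) : z ≠ r := by
  rintro rfl
  obtain ⟨j, h1, h2⟩ := h
  rw [SimpleGraph.dist_self] at h1
  obtain rfl : j = 0 := by omega
  exact hne h2

lemma Desc.parent (hπ : IsParent G r π) {y z : V} (h : Desc G r π y z)
    (hne : z ≠ y) : Desc G r π y (π z) := by
  have hr := h.ne_root hne
  obtain ⟨j, h1, h2⟩ := h
  have h3 := hπ.dist z hr
  cases j with
  | zero => exact absurd h2 hne
  | succ j => exact ⟨j, by omega, h2⟩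

lemma Desc.edist_le (hπ : IsParent G r π) {G' : SimpleGraph V} {y : V}
    (hG' : ∀ z, Desc G r π y z → z ≠ y → G'.Adj (π z) z) {z : V} (h : Desc G r π y z) :
    G'.edist y z ≤ (G.dist r z - G.dist r y : ℕ) := by
  refine edist_le_of_descent {z | Desc G r π y z} (fun z => G.dist r z - G.dist r y) ?_ z h
  intro z hz
  by_cases hne : z = y
  · left; rw [hne]; exact edist_self_le
  · right
    have h1 := hz.parent hπ hne
    have h2 := hπ.dist z (hz.ne_root hne)
    have h3 := h1.dist_le
    exact ⟨π z, h1, hG' z hz hne, by omega⟩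

lemma IsParent.reachable_root_of_not_desc (hπ : IsParent G r π) {p z : V} (hz : ¬ Desc G r π p z) :
    (G.deleteEdges {s(p, π p)}).Reachable r z := by
  have := edist_le_of_descent (G := G.deleteEdges {s(p, π p)}) (x := r) {z | ¬ Desc G r π p z}
    (fun z => G.dist r z) (by
    intro z hz
    by_cases hzr : z = r
    · left; rw [hzr]; exact edist_self_le
    · right
      refine ⟨π z, fun h => hz (hπ.desc_of_parent hzr h), ?_, (hπ.dist z hzr).le⟩
      refine adj_deleteEdges_pair (hπ.adj z hzr) ?_ ?_
      · rintro ⟨h1, -⟩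
        exact hz (hπ.desc_of_parent hzr (h1 ▸ Desc.refl _))
      · rintro ⟨-, rfl⟩
        exact hz (Desc.refl _)) z hz
  exact SimpleGraph.edist_ne_top_iff_reachable.1 (ne_top_of_le_ne_top (ENat.natCast_ne_top _) this)

/-- The non-tree edge leaves the subtree below `p`, so it replaces the edge from `p` to its parent:
tree paths lead from `p` down to `u` and from `u'` to `π p` through the root. -/
lemma IsParent.nonBridge_parent (hπ : IsParent G r π) {p u u' : V}
    (hp : p ≠ r) (hu : Desc G r π p u) (hu' : ¬ Desc G r π p u') (hN : NonTree G π u u') :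
    NonBridge G p (π p) := by
  refine ⟨(hπ.adj p hp).symm, ?_⟩
  have hπp : ¬ Desc G r π p (π p) := by
    intro h
    have := h.dist_le
    have := hπ.dist p hp
    omega
  have h1 := hπ.reachable_root_of_not_desc hu'
  have h2 := hπ.reachable_root_of_not_desc hπp
  have h3 : (G.deleteEdges {s(p, π p)}).Adj u u' := by
    refine adj_deleteEdges_pair hN.1 ?_ ?_
    · rintro ⟨rfl, rfl⟩; exact hN.2.1 rfl
    · rintro ⟨rfl, rfl⟩; exact hN.2.2 rfl
  have h4 := Desc.edist_le (G' := G.deleteEdges {s(p, π p)}) hπ (y := p) (by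
    intro z hz hne
    refine adj_deleteEdges_pair (hπ.adj z (hz.ne_root hne)) ?_ ?_
    · rintro ⟨h, rfl⟩
      have h5 := hπ.dist _ (hz.ne_root hne)
      have h6 := hz.dist_le
      have h7 := hπ.dist p hp
      omega
    · rintro ⟨-, rfl⟩; exact hne rfl) hu
  have h4 := SimpleGraph.edist_ne_top_iff_reachable.1 (ne_top_of_le_ne_top (ENat.natCast_ne_top _) h4)
  exact ((h4.trans h3.reachable).trans h1.symm).trans h2

lemma IsParent.edist_le_of_nonTree (hπ : IsParent G r π) {G' : SimpleGraph V} {u u' : V}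
    (hN : NonTree G π u u')
    (hG' : ∀ c d, G.Adj c d → ¬ (c = u ∧ d = u') → ¬ (c = u' ∧ d = u) → G'.Adj c d) (z : V) :
    G'.edist r z ≤ (G.dist r z : ℕ) := by
  refine edist_le_of_descent Set.univ (fun z => G.dist r z) ?_ z trivial
  intro z _
  by_cases hzr : z = r
  · left; rw [hzr]; exact edist_self_le
  · right
    refine ⟨π z, trivial, hG' _ _ (hπ.adj z hzr) ?_ ?_, (hπ.dist z hzr).le⟩
    · rintro ⟨h, rfl⟩; exact hN.2.2 h.symm
    · rintro ⟨h, rfl⟩; exact hN.2.1 h.symm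

lemma IsParent.nonBridge_of_nonTree (hπ : IsParent G r π) {u u' : V}
    (hN : NonTree G π u u') : NonBridge G u u' := by
  refine ⟨hN.1, ?_⟩
  have h := hπ.edist_le_of_nonTree (G' := G.deleteEdges {s(u, u')}) hN
    fun c d h h1 h2 => adj_deleteEdges_pair h h1 h2
  have h' := fun z => SimpleGraph.edist_ne_top_iff_reachable.1
    (ne_top_of_le_ne_top (ENat.natCast_ne_top _) (h z))
  exact (h' u).symm.trans (h' u')

end Tree

/-! ### Prices above `11n`: the network has no cycle. -/

section Shopping

variable {V : Type*} [Fintype V] [DecidableEq V] {α : ℝ} {s : Profile V} {r : V} {π : V → V}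

/-- Without the edge, `u` climbs to `y` in at most `i` steps and descends to `u'` in at most `i +
1`, so every distance from `u` grows by at most `2i`. -/
lemma le_of_nonTree_of_desc (hs : IsNashEquilibrium α s) (hα : 0 ≤ α)
    (hG : (network s).Connected) (hπ : IsParent (network s) r π) {u u' y : V}
    (hu' : u' ∈ (s u).1) (hN : NonTree (network s) π u u') (hyu : Desc (network s) r π y u)
    (hyu' : Desc (network s) r π y u') {i : ℕ}
    (hi : (network s).dist r u ≤ (network s).dist r y + i) :
    α ≤ 2 * i * Fintype.card V := by
  set G := network s with hGdef
  have dev := hs.deviation hα hG u {u'} ∅ (by simpa using hu') (by simp)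
    (fun z => G.dist u z + 2 * i) (by
    intro G' hG' _
    have hkeep : ∀ c d, G.Adj c d → ¬ (c = u ∧ d = u') → ¬ (c = u' ∧ d = u) → G'.Adj c d := by
      intro c d hcd h h'
      refine hG' c d hcd ?_ ?_
      · rintro rfl; simpa using fun e => h ⟨rfl, e⟩
      · rintro rfl; simpa using fun e => h' ⟨e, rfl⟩
    have htree : ∀ z, Desc G r π y z → z ≠ y → G'.Adj (π z) z := by
      intro z hz hne
      refine hkeep _ _ (hπ.adj z (hz.ne_root hne)) ?_ ?_
      · rintro ⟨h, rfl⟩; exact hN.2.2 h.symm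
      · rintro ⟨h, rfl⟩; exact hN.2.1 h.symm
    have huu' : G'.edist u u' ≤ (1 + 2 * i : ℕ) := by
      have h1 := Desc.edist_le hπ htree hyu
      have h2 := Desc.edist_le hπ htree hyu'
      have h3 := dist_le_dist_succ (hG.preconnected r u) hN.1
      have h4 := hyu.dist_le
      rw [SimpleGraph.edist_comm] at h1
      calc G'.edist u u' ≤ G'.edist u y + G'.edist y u' := SimpleGraph.edist_triangle
        _ ≤ ((G.dist r u - G.dist r y : ℕ) : ℕ∞) + (G.dist r u' - G.dist r y : ℕ) :=
          add_le_add h1 h2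
        _ ≤ ((1 + 2 * i : ℕ) : ℕ∞) := by exact_mod_cast (by omega)
    intro z
    refine edist_le_of_descent Set.univ (fun z => G.dist u z + 2 * i) ?_ z trivial
    intro z _
    by_cases hzu : z = u
    · left; rw [hzu]; exact edist_self_le
    obtain ⟨w, hwz, -, hd⟩ := exists_adj_dist_succ (hG.preconnected u z) hzu
    by_cases hw : w = u ∧ z = u'
    · left
      obtain ⟨rfl, rfl⟩ := hw
      refine edist_le_of_le huu' ?_
      omega
    · right
      exact ⟨w, trivial, hkeep _ _ hwz hw (fun e => hzu e.2), by omega⟩)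
  push_cast [Finset.sum_add_distrib] at dev
  simp only [Finset.sum_const, Finset.card_univ, nsmul_eq_mul, Finset.card_singleton,
    Finset.card_empty, Nat.cast_one, Nat.cast_zero, mul_one, mul_zero, zero_add] at dev
  linarith

/-- An edge bought by `x` which is a parent edge, a non-tree edge, or an edge to a child which has a
near descendant that buys a non-tree edge leaving the descendants of `x`. -/
def Special (s : Profile V) (r : V) (π : V → V) (x v : V) : Prop :=
  v ∈ (s x).1 ∧ (v = π x ∨ NonTree (network s) π x v ∨
    (x = π v ∧ ∃ u u', NonTree (network s) π u u' ∧ Desc (network s) r π v u ∧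
      ¬ Desc (network s) r π x u' ∧ (network s).dist r u ≤ (network s).dist r v + 4))

/-- Trading both edges for a link to `r` saves one price, and puts `x` within 11 of the distances of
`r`. By the choice of `r`, these sum to no more than those of `x`. -/
lemma le_of_two_special (hs : IsNashEquilibrium α s) (hα : 0 ≤ α)
    (hG : (network s).Connected) (hπ : IsParent (network s) r π) {x v₁ v₂ : V} (hx : x ≠ r)
    (hne : v₁ ≠ v₂) (h₁ : Special s r π x v₁) (h₂ : Special s r π x v₂)
    (hr : ∑ z, ((network s).dist r z : ℝ) ≤ ∑ z, ((network s).dist x z : ℝ)) :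
    α ≤ 11 * Fintype.card V := by
  set G := network s with hGdef
  have dev := hs.deviation hα hG x {v₁, v₂} {r}
    (by intro v; simp only [Finset.mem_insert, Finset.mem_singleton]
        rintro (rfl | rfl); exacts [h₁.1, h₂.1])
    (by simpa using hx) (fun z => G.dist r z + 11) (by
    intro G' hG' hA
    have hxr : G'.Adj x r := hA r (by simp)
    have hkeep : ∀ c d, G.Adj c d → c ≠ x → d ≠ x → G'.Adj c d := fun c d hcd h h' =>
      hG' c d hcd (fun e => absurd e h) (fun e => absurd e h')
    -- The tree path from `r` to a vertex not below `x` avoids `x`, so the deviation leaves it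
    -- intact.
    have hup : ∀ z ∈ {z | ¬ Desc G r π x z}, G'.edist x z ≤ (G.dist r z + 1 : ℕ) := by
      refine edist_le_of_descent _ (fun z => G.dist r z + 1) ?_
      intro z hz
      by_cases hzr : z = r
      · left; rw [hzr]; exact edist_le_of_adj hxr (by omega)
      · right
        have hz' : ¬ Desc G r π x (π z) := fun h => hz (hπ.desc_of_parent hzr h)
        refine ⟨π z, hz', hkeep _ _ (hπ.adj z hzr) ?_ ?_, ?_⟩
        · intro e; exact hz' (e ▸ Desc.refl _)
        · rintro rfl; exact hz (Desc.refl _)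
        · have := hπ.dist z hzr; omega
    have hspec : ∀ v, v ≠ r → x = π v → Special s r π x v →
        G'.edist x v ≤ (G.dist r v + 11 : ℕ) := by
      intro v hvr hxv hv
      have hdv := hπ.dist v hvr
      rw [← hxv] at hdv
      rcases hv.2 with h | h | ⟨-, u, u', hN, hu, hu', hd⟩
      · have := hπ.dist x hx
        rw [← h] at this; omega
      · exact absurd hxv h.2.2
      · rw [← hGdef] at hd hu
        have hvx : ∀ z, Desc G r π v z → z ≠ x := by
          rintro z hz rfl
          have := hz.dist_le; omega
        have hd' := dist_le_dist_succ (hG.preconnected r u) hN.1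
        have e1 := hup u' hu'
        have e2 : G'.edist x u ≤ (G.dist r u' + 1 + 1 : ℕ) :=
          edist_le_succ_of_adj (hkeep _ _ hN.1.symm (fun e => hu' (e ▸ Desc.refl _)) (hvx u hu)) e1
        have e3 : G'.edist u v ≤ (G.dist r u - G.dist r v : ℕ) := by
          rw [SimpleGraph.edist_comm]
          refine Desc.edist_le hπ ?_ hu
          intro z hz hzv
          exact hkeep _ _ (hπ.adj z (hz.ne_root hzv)) (hvx _ (hz.parent hπ hzv)) (hvx _ hz)
        have := hu.dist_le
        -- A child `v` cut off from `x` is reached through `r`, `u'` and `u`. As `u` is at most 4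
        -- levels below `v` and `u'` at most one below `u`, this is the depth of `v` plus at most 4
        -- + 1 + 2, plus 4 for the climb from `u` to `v`.
        calc G'.edist x v ≤ G'.edist x u + G'.edist u v := SimpleGraph.edist_triangle
          _ ≤ ((G.dist r u' + 1 + 1 : ℕ) : ℕ∞) + (G.dist r u - G.dist r v : ℕ) := add_le_add e2 e3
          _ ≤ ((G.dist r v + 11 : ℕ) : ℕ∞) := by exact_mod_cast (by omega)
    intro z
    by_cases hz : Desc G r π x z
    swap
    · exact edist_le_of_le (hup z hz) (by omega)
    refine edist_le_of_descent {z | Desc G r π x z} (fun z => G.dist r z + 11) ?_ z hz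
    intro z hz
    by_cases hzx : z = x
    · left; rw [hzx]; exact edist_self_le
    have hzr := hz.ne_root hzx
    have hd := hπ.dist z hzr
    by_cases hxz : x = π z
    · by_cases hz1 : z = v₁
      · left; exact hspec z hzr hxz (hz1 ▸ h₁)
      by_cases hz2 : z = v₂
      · left; exact hspec z hzr hxz (hz2 ▸ h₂)
      right
      refine ⟨π z, hz.parent hπ hzx, hG' _ _ (hπ.adj z hzr) ?_ ?_, by omega⟩
      · intro _; simp [hz1, hz2]
      · intro h; exact absurd h hzx
    · right
      exact ⟨π z, hz.parent hπ hzx, hkeep _ _ (hπ.adj z hzr) (Ne.symm hxz) hzx, by omega⟩)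
  rw [Finset.card_pair hne] at dev
  push_cast [Finset.sum_add_distrib] at dev
  simp only [Finset.sum_const, Finset.card_univ, nsmul_eq_mul, Finset.card_singleton,
    Nat.cast_one, mul_one] at dev
  linarith

section Chain

variable (hs : IsNashEquilibrium α s) (hα : 11 * (Fintype.card V : ℝ) < α)
  (hG : (network s).Connected) (hπ : IsParent (network s) r π)
  (hr : ∀ x, ∑ z, ((network s).dist r z : ℝ) ≤ ∑ z, ((network s).dist x z : ℝ))

include hs hα hG hπ

lemma lt_dist_of_nonTree {u u' : V} (hu' : u' ∈ (s u).1) (hN : NonTree (network s) π u u') :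
    5 < (network s).dist r u := by
  by_contra! h
  have h1 := le_of_nonTree_of_desc hs (le_trans (by positivity) hα.le) hG hπ hu' hN
    (hπ.desc_root hG u) (hπ.desc_root hG u') (i := 5) (by omega)
  push_cast at h1
  have : (0 : ℝ) ≤ Fintype.card V := by positivity
  linarith

lemma not_desc_of_nonTree {u u' : V} (hu' : u' ∈ (s u).1) (hN : NonTree (network s) π u u')
    {j : ℕ} (hj : j ≤ 5) : ¬ Desc (network s) r π (π^[j] u) u' := by
  intro h
  have h0 := lt_dist_of_nonTree hs hα hG hπ hu' hN
  have h2 := hπ.dist_iterate u j (by omega)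
  have h1 := le_of_nonTree_of_desc hs (le_trans (by positivity) hα.le) hG hπ hu' hN
    (hπ.desc_iterate (by omega)) h (i := 5) (by omega)
  push_cast at h1
  have : (0 : ℝ) ≤ Fintype.card V := by positivity
  linarith

lemma iterate_ne_root {u u' : V} (hu' : u' ∈ (s u).1) (hN : NonTree (network s) π u u')
    {j : ℕ} (hj : j ≤ 5) : π^[j] u ≠ r := fun h =>
  not_desc_of_nonTree hs hα hG hπ hu' hN hj (h ▸ hπ.desc_root hG u')

include hr

lemma special_unique {x v₁ v₂ : V} (hx : x ≠ r)
    (h₁ : Special s r π x v₁) (h₂ : Special s r π x v₂) : v₁ = v₂ := by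
  by_contra hne
  exact absurd (le_of_two_special hs (le_trans (by positivity) hα.le) hG hπ hx hne h₁ h₂ (hr x))
    (not_le.2 hα)

/-- A vertex that buys a special edge other than its parent edge cannot buy the parent edge as well,
since that is also special. So the parent bought it, which gives the parent a special edge of the
third kind, and the argument moves up one level. -/
lemma special_iterate {u u' : V} (hu' : u' ∈ (s u).1) (hN : NonTree (network s) π u u') :
    ∀ j, j ≤ 4 → Special s r π (π^[j + 1] u) (π^[j] u) := by
  have h0 := lt_dist_of_nonTree hs hα hG hπ hu' hN
  have key : ∀ j, j ≤ 4 → (∃ v, Special s r π (π^[j] u) v ∧ v ≠ π (π^[j] u)) →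
      Special s r π (π^[j + 1] u) (π^[j] u) := by
    rintro j hj ⟨v, hv, hne⟩
    have hjr := iterate_ne_root hs hα hG hπ hu' hN (j := j) (by omega)
    have hadj := hπ.adj _ hjr
    have hd := hπ.dist_iterate u j (by omega)
    rw [Function.iterate_succ_apply']
    rcases hadj with h | h
    · refine ⟨h, Or.inr (Or.inr ⟨rfl, u, u', hN, hπ.desc_iterate (by omega), ?_, by omega⟩)⟩
      rw [← Function.iterate_succ_apply' π j u]
      exact not_desc_of_nonTree hs hα hG hπ hu' hN (by omega)
    · exact absurd (special_unique hs hα hG hπ hr hjr hv ⟨h, Or.inl rfl⟩) hne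
  intro j
  induction j with
  | zero => intro hj; exact key 0 hj ⟨u', ⟨hu', Or.inr (Or.inl hN)⟩, hN.2.1⟩
  | succ j ih =>
    intro hj
    refine key (j + 1) hj ⟨_, ih (by omega), ?_⟩
    rw [← Function.iterate_succ_apply' π]
    intro h
    have h1 := hπ.dist_iterate u j (by omega)
    have h2 := hπ.dist_iterate u (j + 1 + 1) (by omega)
    rw [← h] at h2
    omega

/-- A vertex has only one special edge, so two chains that meet agree all the way down. They also
end together: a chain continuing below `u` would give `u` a special edge to a child besides its
non-tree edge. -/
lemma iterate_inj {u u' w w' : V} (hu' : u' ∈ (s u).1) (hN : NonTree (network s) π u u')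
    (hw' : w' ∈ (s w).1) (hM : NonTree (network s) π w w') :
    ∀ i j, i ≤ 5 → j ≤ 5 → π^[i] u = π^[j] w → i = j ∧ u = w := by
  have aux : ∀ {u u' w w' : V}, u' ∈ (s u).1 → NonTree (network s) π u u' → w' ∈ (s w).1 →
      NonTree (network s) π w w' → ∀ j, j ≤ 4 → u ≠ π^[j + 1] w := by
    intro u u' w w' hu' hN hw' hM j hj h
    have h1 := special_iterate hs hα hG hπ hr hw' hM j hj
    have hjr := iterate_ne_root hs hα hG hπ hw' hM (j := j + 1) (by omega)
    rw [← h] at h1 hjr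
    have h2 := special_unique hs hα hG hπ hr hjr h1 ⟨hu', Or.inr (Or.inl hN)⟩
    rw [Function.iterate_succ_apply', h2] at h
    exact hN.2.2 h
  intro i
  induction i with
  | zero =>
    intro j _ hj h
    cases j with
    | zero => exact ⟨rfl, h⟩
    | succ j => exact absurd h (aux hu' hN hw' hM j (by omega))
  | succ i ih =>
    intro j hi hj h
    cases j with
    | zero => exact absurd h.symm (aux hw' hM hu' hN i (by omega))
    | succ j =>
      have h1 := special_iterate hs hα hG hπ hr hu' hN i (by omega)
      have h2 := special_iterate hs hα hG hπ hr hw' hM j (by omega)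
      rw [← h] at h2
      have h3 := special_unique hs hα hG hπ hr
        (iterate_ne_root hs hα hG hπ hu' hN (by omega)) h1 h2
      obtain ⟨rfl, h4⟩ := ih j (by omega) (by omega) h3
      exact ⟨rfl, h4⟩

end Chain

theorem not_nonBridge (hs : IsNashEquilibrium α s) (hα : 11 * (Fintype.card V : ℝ) < α)
    (hG : (network s).Connected) (a b : V) : ¬ NonBridge (network s) a b := by
  classical
  intro hNab
  have : Nonempty V := ⟨a⟩
  obtain ⟨r, -, hr⟩ := Finset.exists_min_image Finset.univ
    (fun x => ∑ z, ((network s).dist x z : ℝ)) Finset.univ_nonempty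
  have hr : ∀ x, ∑ z, ((network s).dist r z : ℝ) ≤ ∑ z, ((network s).dist x z : ℝ) :=
    fun x => hr x (Finset.mem_univ x)
  obtain ⟨π, hπ⟩ := exists_isParent hG r
  set G := network s with hGdef
  set K := Finset.univ.filter fun u => ∃ u', u' ∈ (s u).1 ∧ NonTree G π u u' with hK
  set N := Finset.univ.filter fun x => ∃ y, NonBridge G x y with hN
  set E := Finset.univ.filter fun p : V × V => NonBridge G p.1 p.2 with hE
  have hEN1 : ∀ p ∈ E, p.1 ∈ N := by
    intro p hp
    simp only [hE, hN, Finset.mem_filter, Finset.mem_univ, true_and] at hp ⊢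
    exact ⟨_, hp⟩
  have hEN2 : ∀ p ∈ E, p.2 ∈ N := by
    intro p hp
    simp only [hE, hN, Finset.mem_filter, Finset.mem_univ, true_and] at hp ⊢
    exact ⟨_, hp.symm⟩
  -- Each buyer of a non-tree edge accounts for six vertices of `N`: itself and five ancestors.
  -- Chains of five would only give an average degree of at most 12/5, which is no contradiction.
  have hchain : (K ×ˢ Finset.range 6).card ≤ N.card := by
    refine Finset.card_le_card_of_injOn (fun p => π^[p.2] p.1) ?_ ?_
    · rintro ⟨u, j⟩ hp
      simp only [Finset.coe_product, Set.mem_prod, Finset.mem_coe, hK, Finset.mem_filter,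
        Finset.mem_univ, true_and, Finset.mem_range] at hp
      obtain ⟨⟨u', hu', hNT⟩, hj⟩ := hp
      have h0 := lt_dist_of_nonTree hs hα hG hπ hu' hNT
      simp only [hN, Finset.coe_filter, Finset.mem_univ, true_and, Set.mem_ofPred_eq]
      exact ⟨_, hπ.nonBridge_parent (iterate_ne_root hs hα hG hπ hu' hNT (by omega))
        (hπ.desc_iterate (by rw [← hGdef] at h0; omega))
        (not_desc_of_nonTree hs hα hG hπ hu' hNT (by omega)) hNT⟩
    · rintro ⟨u, i⟩ hp ⟨w, j⟩ hq h
      simp only [Finset.coe_product, Set.mem_prod, Finset.mem_coe, hK, Finset.mem_filter,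
        Finset.mem_univ, true_and, Finset.mem_range] at hp hq h
      obtain ⟨⟨u', hu', hNT⟩, hi⟩ := hp
      obtain ⟨⟨w', hw', hMT⟩, hj⟩ := hq
      obtain ⟨h1, h2⟩ := iterate_inj hs hα hG hπ hr hu' hNT hw' hMT i j (by omega) (by omega) h
      rw [h1, h2]
  rw [Finset.card_product, Finset.card_range] at hchain
  have huniq : ∀ u v w, v ∈ (s u).1 → NonTree G π u v → w ∈ (s u).1 → NonTree G π u w → v = w := by
    intro u v w hv hNv hw hNw
    exact special_unique hs hα hG hπ hr
      (iterate_ne_root hs hα hG hπ hv hNv (j := 0) (by omega))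
      ⟨hv, Or.inr (Or.inl hNv)⟩ ⟨hw, Or.inr (Or.inl hNw)⟩
  -- Ordered pairs are counted: each vertex has at most one parent edge and buys at most one
  -- non-tree edge, and each edge is seen in two directions.
  have hupper : E.card ≤ 2 * N.card + 2 * K.card := by
    set E1 := E.filter fun p => p.2 = π p.1 with hE1
    set E2 := E.filter fun p => p.1 = π p.2 with hE2
    set E3 := E.filter fun p => p.2 ∈ (s p.1).1 ∧ NonTree G π p.1 p.2 with hE3
    set E4 := E.filter fun p => p.1 ∈ (s p.2).1 ∧ NonTree G π p.2 p.1 with hE4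
    have hsub : E ⊆ (E1 ∪ E2) ∪ (E3 ∪ E4) := by
      rintro ⟨v, w⟩ hp
      have hadj : G.Adj v w := (Finset.mem_filter.1 hp).2.1
      simp only [Finset.mem_union, hE1, hE2, hE3, hE4, Finset.mem_filter, hp, true_and]
      by_cases h1 : w = π v
      · exact Or.inl (Or.inl h1)
      by_cases h2 : v = π w
      · exact Or.inl (Or.inr h2)
      have hNT : NonTree G π v w := ⟨hadj, h1, h2⟩
      rcases hadj with h | h
      · exact Or.inr (Or.inl ⟨h, hNT⟩)
      · exact Or.inr (Or.inr ⟨h, hNT.symm⟩)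
    have c1 : E1.card ≤ N.card := by
      refine Finset.card_le_card_of_injOn Prod.fst
        (fun p hp => hEN1 p (Finset.mem_filter.1 hp).1) ?_
      intro p hp q hq h
      have h1 := (Finset.mem_filter.1 hp).2
      have h2 := (Finset.mem_filter.1 hq).2
      exact Prod.ext h (by rw [h1, h2, h])
    have c2 : E2.card ≤ N.card := by
      refine Finset.card_le_card_of_injOn Prod.snd
        (fun p hp => hEN2 p (Finset.mem_filter.1 hp).1) ?_
      intro p hp q hq h
      have h1 := (Finset.mem_filter.1 hp).2
      have h2 := (Finset.mem_filter.1 hq).2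
      exact Prod.ext (by rw [h1, h2, h]) h
    have c3 : E3.card ≤ K.card := by
      refine Finset.card_le_card_of_injOn Prod.fst ?_ ?_
      · intro p hp
        exact Finset.mem_filter.2 ⟨Finset.mem_univ _, p.2, (Finset.mem_filter.1 hp).2⟩
      · rintro ⟨p1, p2⟩ hp ⟨q1, q2⟩ hq h
        obtain ⟨h1, h1'⟩ := (Finset.mem_filter.1 hp).2
        obtain ⟨h2, h2'⟩ := (Finset.mem_filter.1 hq).2
        obtain rfl : p1 = q1 := h
        exact Prod.ext rfl (huniq _ _ _ h1 h1' h2 h2')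
    have c4 : E4.card ≤ K.card := by
      refine Finset.card_le_card_of_injOn Prod.snd ?_ ?_
      · intro p hp
        exact Finset.mem_filter.2 ⟨Finset.mem_univ _, p.1, (Finset.mem_filter.1 hp).2⟩
      · rintro ⟨p1, p2⟩ hp ⟨q1, q2⟩ hq h
        obtain ⟨h1, h1'⟩ := (Finset.mem_filter.1 hp).2
        obtain ⟨h2, h2'⟩ := (Finset.mem_filter.1 hq).2
        obtain rfl : p2 = q2 := h
        exact Prod.ext (huniq _ _ _ h1 h1' h2 h2') rfl
    have := Finset.card_le_card hsub
    have := Finset.card_union_le (E1 ∪ E2) (E3 ∪ E4)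
    have := Finset.card_union_le E1 E2
    have := Finset.card_union_le E3 E4
    omega
  set nb : V → Finset V := fun x => Finset.univ.filter fun y => NonBridge G x y with hnb
  have hmem : ∀ x y, y ∈ nb x ↔ NonBridge G x y := by
    intro x y; simp [hnb]
  have hdeg : ∀ x ∈ N, 2 ≤ (nb x).card := by
    intro x hx
    obtain ⟨y, hy⟩ := (Finset.mem_filter.1 hx).2
    obtain ⟨c, hcy, hc, -⟩ := hy.exists_other
    rw [← Finset.card_pair hcy]
    refine Finset.card_le_card ?_
    intro v
    simp only [Finset.mem_insert, Finset.mem_singleton]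
    rintro (rfl | rfl) <;> rwa [hmem]
  have hown : ∀ x y, (nb x).card = 2 → NonBridge G x y → y ∉ (s x).1 := by
    intro x y hx hy
    obtain ⟨c, d, hcd, h⟩ := Finset.card_eq_two.1 hx
    have hiff : ∀ z, NonBridge G x z ↔ z = c ∨ z = d := by
      intro z; rw [← hmem, h]; simp
    have hα8 : 8 * (Fintype.card V : ℝ) ≤ α := by
      have : (0 : ℝ) ≤ Fintype.card V := by positivity
      linarith
    rcases (hiff y).1 hy with rfl | rfl
    · exact not_owner_of_two_nonBridge hs hα8 hG hcd hiff
    · exact not_owner_of_two_nonBridge hs hα8 hG hcd.symm fun z => by rw [hiff, or_comm]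
  set N2 := N.filter fun x => (nb x).card = 2 with hN2
  set N3 := N.filter fun x => ¬ (nb x).card = 2 with hN3
  have hNsplit : N2.card + N3.card = N.card := Finset.card_filter_add_card_filter_not _
  set F2 := E.filter fun p => (nb p.1).card = 2 with hF2
  set F3 := E.filter fun p => ¬ (nb p.1).card = 2 with hF3
  have hEsplit : F2.card + F3.card = E.card := Finset.card_filter_add_card_filter_not _
  have hfib : ∀ (P : V → Prop) [DecidablePred P], ∀ x ∈ N.filter P,
      ((E.filter fun p => P p.1).filter fun p => p.1 = x).card = (nb x).card := by
    intro P _ x hx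
    refine Finset.card_bij' (fun p _ => p.2) (fun y _ => (x, y)) ?_ ?_ ?_ ?_
    · rintro ⟨v, w⟩ hp
      simp only [Finset.mem_filter, hE, Finset.mem_univ, true_and] at hp
      obtain ⟨⟨h1, h2⟩, rfl⟩ := hp
      exact (hmem _ _).2 h1
    · intro y hy
      simp only [Finset.mem_filter, hE, Finset.mem_univ, true_and]
      exact ⟨⟨(hmem _ _).1 hy, (Finset.mem_filter.1 hx).2⟩, trivial⟩
    · rintro ⟨v, w⟩ hp
      exact Prod.ext (Finset.mem_filter.1 hp).2.symm rfl
    · intro y hy; rfl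
  have hF2card : F2.card = 2 * N2.card := by
    rw [Finset.card_eq_sum_card_fiberwise (f := Prod.fst) (t := N2), Finset.sum_congr rfl
      (fun x hx => (hfib (fun x => (nb x).card = 2) x hx).trans (Finset.mem_filter.1 hx).2)]
    · rw [Finset.sum_const, smul_eq_mul]
      exact mul_comm _ _
    · intro p hp
      have hp := Finset.mem_filter.1 hp
      exact Finset.mem_filter.2 ⟨hEN1 p hp.1, hp.2⟩
  have hF3card : 3 * N3.card ≤ F3.card := by
    rw [Finset.card_eq_sum_card_fiberwise (f := Prod.fst) (t := N3), Finset.sum_congr rfl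
      (fun x hx => hfib (fun x => ¬ (nb x).card = 2) x hx), mul_comm, ← smul_eq_mul]
    · refine Finset.card_nsmul_le_sum _ _ _ ?_
      intro x hx
      have hx := Finset.mem_filter.1 hx
      have := hdeg x hx.1
      have := hx.2
      omega
    · intro p hp
      have hp := Finset.mem_filter.1 hp
      exact Finset.mem_filter.2 ⟨hEN1 p hp.1, hp.2⟩
  -- A non-bridge edge with both ends of degree two would have no buyer, so reversing pairs maps
  -- `F2` into `F3`.
  have hF23 : F2.card ≤ F3.card := by
    refine Finset.card_le_card_of_injOn Prod.swap ?_ (Prod.swap_injective.injOn)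
    rintro ⟨v, w⟩ hp
    obtain ⟨hp, h2⟩ := Finset.mem_filter.1 hp
    have hvw : NonBridge G v w := (Finset.mem_filter.1 hp).2
    refine Finset.mem_filter.2 ⟨Finset.mem_filter.2 ⟨Finset.mem_univ _, hvw.symm⟩, ?_⟩
    intro h2'
    rcases hvw.1 with h | h
    · exact hown v w h2 hvw h
    · exact hown w v h2' hvw.symm h
  have hpos : 0 < N.card := Finset.card_pos.2 ⟨a, Finset.mem_filter.2 ⟨Finset.mem_univ _, b, hNab⟩⟩
  -- The upper bound gives `3|E| ≤ 7|N|`, while `|F2| = 2|N2|`, `|F3| ≥ 3|N3|` and `|F2| ≤ |F3|`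
  -- give `5|E| ≥ 12|N|`.
  omega

end Shopping

/-! ### Biconnected components and the sets `T(u)`. -/

section Ear

variable {V : Type*} {G : SimpleGraph V}

/-- The edges of `G` inside of the vertex set `A`. -/
def within (G : SimpleGraph V) (A : Set V) : SimpleGraph V where
  Adj a b := G.Adj a b ∧ a ∈ A ∧ b ∈ A
  symm := ⟨fun _ _ h => ⟨h.1.symm, h.2.2, h.2.1⟩⟩
  loopless := ⟨fun a h => G.loopless.irrefl a h.1⟩

/-- Connectivity is argued on `V` itself through `within`; this lifts it back to the nested subtypes
in which biconnectedness is phrased. -/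
lemma exists_lift_of_within_reachable {T : Type*} {L : SimpleGraph T} {f : T → V} {A : Set V}
    (hf : ∀ t b, b ∈ A → G.Adj (f t) b → ∃ t', f t' = b ∧ L.Adj t t') {t : T} {b : V}
    (h : (within G A).Reachable (f t) b) : ∃ t', f t' = b ∧ L.Reachable t t' := by
  obtain ⟨p⟩ := h
  have key : ∀ {a b : V} (p : (within G A).Walk a b) (t : T), f t = a →
      ∃ t', f t' = b ∧ L.Reachable t t' := by
    intro a b p
    induction p with
    | nil => exact fun t ht => ⟨t, ht, SimpleGraph.Reachable.refl _⟩
    | cons hab p ih =>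
      intro t ht
      obtain ⟨t₁, h1, h2⟩ := hf t _ hab.2.2 (ht ▸ hab.1)
      obtain ⟨t₂, h3, h4⟩ := ih t₁ h1
      exact ⟨t₂, h3, h2.reachable.trans h4⟩
  exact key p t rfl

lemma within_reachable_of_reachable {T : Type*} {L : SimpleGraph T} {f : T → V} {A : Set V}
    (hf : ∀ t t', L.Adj t t' → (within G A).Adj (f t) (f t')) {t t' : T} (h : L.Reachable t t') :
    (within G A).Reachable (f t) (f t') :=
  h.map (⟨f, fun {a b} h => hf a b h⟩ : L →g within G A)

/-- Removing at most one vertex leaves each remaining ear vertex a way along the ear to one of its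
ends in `B`. Taking `X` empty yields connectedness, and a singleton yields the absence of cut
vertices. -/
lemma within_ear_reachable {B S X : Set V} {n : ℕ} {w : ℕ → V} {z : V}
    (hBS : B ⊆ S) (hS : ∀ a ∈ S, a ∈ B ∨ ∃ i ≤ n, w i = a) (hwS : ∀ i ≤ n, w i ∈ S)
    (hw : ∀ i < n, G.Adj (w i) (w (i + 1)))
    (hinj : ∀ i ≤ n, ∀ j ≤ n, w i = w j → i = j)
    (h0 : w 0 ∈ B) (hz : z ∈ B) (hzw : ∀ i ≤ n, w i ≠ z) (hnz : G.Adj (w n) z)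
    (hX : X.Subsingleton)
    (hB : ∀ a ∈ B \ X, ∀ b ∈ B \ X, (within G (S \ X)).Reachable a b) :
    ∀ a ∈ S \ X, ∀ b ∈ S \ X, (within G (S \ X)).Reachable a b := by
  have down : ∀ i ≤ n, (∀ j ≤ i, w j ∉ X) → (within G (S \ X)).Reachable (w i) (w 0) := by
    intro i
    induction i with
    | zero => intro _ _; exact SimpleGraph.Reachable.refl _
    | succ i ih =>
      intro hi h
      have hadj : (within G (S \ X)).Adj (w i) (w (i + 1)) :=
        ⟨hw i (by omega), ⟨hwS i (by omega), h i (by omega)⟩, ⟨hwS _ hi, h _ le_rfl⟩⟩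
      exact hadj.symm.reachable.trans (ih (by omega) fun j hj => h j (by omega))
  have up : ∀ k i, i + k = n → (∀ j, i ≤ j → j ≤ n → w j ∉ X) →
      (within G (S \ X)).Reachable (w i) (w n) := by
    intro k
    induction k with
    | zero => intro i hi _; obtain rfl : i = n := by omega
              exact SimpleGraph.Reachable.refl _
    | succ k ih =>
      intro i hi h
      have hadj : (within G (S \ X)).Adj (w i) (w (i + 1)) :=
        ⟨hw i (by omega), ⟨hwS i (by omega), h i le_rfl (by omega)⟩,
          ⟨hwS _ (by omega), h _ (by omega) (by omega)⟩⟩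
      exact hadj.reachable.trans (ih (i + 1) (by omega) fun j hj hj' => h j (by omega) hj')
  have key : ∀ a ∈ S \ X, ∃ b ∈ B \ X, (within G (S \ X)).Reachable a b := by
    rintro a ⟨haS, haX⟩
    rcases hS a haS with ha | ⟨i, hi, rfl⟩
    · exact ⟨a, ⟨ha, haX⟩, SimpleGraph.Reachable.refl _⟩
    · by_cases h : ∃ j ≤ i, w j ∈ X
      · obtain ⟨j, hj, hjX⟩ := h
        have hjn : j ≤ n := by omega
        have hij : i ≠ j := by rintro rfl; exact haX hjX
        have hup : ∀ j', i ≤ j' → j' ≤ n → w j' ∉ X := by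
          intro j' h1 h2 h3
          have := hinj j' h2 j hjn (hX h3 hjX)
          omega
        have hzX : z ∉ X := fun hzX => hzw j hjn (hX hjX hzX)
        refine ⟨z, ⟨hz, hzX⟩, (up (n - i) i (by omega) hup).trans ?_⟩
        have hadj : (within G (S \ X)).Adj (w n) z :=
          ⟨hnz, ⟨hwS n le_rfl, hup n hi le_rfl⟩, ⟨hBS hz, hzX⟩⟩
        exact hadj.reachable
      · push Not at h
        exact ⟨w 0, ⟨h0, h 0 (by omega)⟩, down i hi h⟩
  intro a ha b hb
  obtain ⟨a', ha', h1⟩ := key a ha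
  obtain ⟨b', hb', h2⟩ := key b hb
  exact (h1.trans (hB a' ha' b' hb')).trans h2.symm

lemma preconnected_of_within {S : Set V}
    (h : ∀ a ∈ S, ∀ b ∈ S, (within G S).Reachable a b) :
    ((⊤ : G.Subgraph).induce S).coe.Preconnected := by
  rintro ⟨a, ha⟩ ⟨b, hb⟩
  obtain ⟨⟨t, ht⟩, rfl, h2⟩ := exists_lift_of_within_reachable
    (L := ((⊤ : G.Subgraph).induce S).coe) (f := Subtype.val) (A := S) (by
      rintro ⟨t, ht⟩ c hc htc
      exact ⟨⟨c, hc⟩, rfl, ht, hc, htc⟩) (t := ⟨a, ha⟩) (h a ha b hb)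
  exact h2

lemma induce_preconnected_of_within {S : Set V} (v : ((⊤ : G.Subgraph).induce S).verts)
    (h : ∀ a ∈ S \ {v.1}, ∀ b ∈ S \ {v.1}, (within G (S \ {v.1})).Reachable a b) :
    (((⊤ : G.Subgraph).induce S).coe.induce {v}ᶜ).Preconnected := by
  rintro ⟨⟨a, ha⟩, hav⟩ ⟨⟨b, hb⟩, hbv⟩
  have hav' : a ≠ v.1 := fun e => hav (Subtype.ext e)
  have hbv' : b ≠ v.1 := fun e => hbv (Subtype.ext e)
  obtain ⟨⟨⟨t, ht⟩, htv⟩, rfl, h2⟩ := exists_lift_of_within_reachable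
    (L := ((⊤ : G.Subgraph).induce S).coe.induce {v}ᶜ) (f := fun t => t.1.1) (A := S \ {v.1}) (by
      rintro ⟨⟨t, ht⟩, htv⟩ c ⟨hc, hcv⟩ htc
      exact ⟨⟨⟨c, hc⟩, fun e => hcv (congrArg Subtype.val e)⟩, rfl, ht, hc, htc⟩)
    (t := ⟨⟨a, ha⟩, hav⟩) (h a ⟨ha, hav'⟩ b ⟨hb, hbv'⟩)
  exact h2

/-- Such an edge would close an ear from `u` through `y` to `z`, and `H` with this ear would be a
larger biconnected subgraph. -/
lemma IsBiconnectedComponent.not_adj_ear {H : G.Subgraph} (hH : IsBiconnectedComponent H)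
    {u y z : V} (hu : u ∈ H.verts) (hy : y ∈ insert u H.vertsᶜ) (hyu : y ≠ u)
    (hr : (G.induce (insert u H.vertsᶜ)).Reachable ⟨u, Set.mem_insert u _⟩ ⟨y, hy⟩)
    (hz : z ∈ H.verts) (hzu : z ≠ u) : ¬ G.Adj y z := by
  classical
  intro hyz
  obtain ⟨p, hp⟩ := hr.exists_isPath
  set w : ℕ → V := fun i => (p.getVert i).1 with hw
  set S : Set V := H.verts ∪ {a | ∃ i ≤ p.length, w i = a} with hS
  have hw0 : w 0 = u := by simp [hw]
  have hwn : w p.length = y := by simp [hw]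
  have hzw : ∀ i ≤ p.length, w i ≠ z := by
    intro i _ h
    have := (p.getVert i).2
    rw [show (p.getVert i).1 = z from h] at this
    exact this.elim hzu fun h => h hz
  have ear : ∀ X : Set V, X.Subsingleton →
      (∀ a ∈ H.verts \ X, ∀ b ∈ H.verts \ X, (within G (S \ X)).Reachable a b) →
      ∀ a ∈ S \ X, ∀ b ∈ S \ X, (within G (S \ X)).Reachable a b := by
    intro X hX
    refine within_ear_reachable (n := p.length) (w := w) (z := z) Set.subset_union_left
      (fun a ha => ha) (fun i hi => Or.inr ⟨i, hi, rfl⟩) ?_ ?_ (by rw [hw0]; exact hu) hz hzw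
      (by rw [hwn]; exact hyz) hX
    · intro i hi
      exact p.adj_getVert_succ hi
    · intro i hi j hj h
      exact hp.getVert_injOn hi hj (Subtype.ext h)
  have hHconn := hH.prop.1
  have whole : ∀ X : Set V, Disjoint X H.verts → ∀ a ∈ H.verts \ X, ∀ b ∈ H.verts \ X,
      (within G (S \ X)).Reachable a b := by
    rintro X hX a ⟨ha, -⟩ b ⟨hb, -⟩
    refine within_reachable_of_reachable (L := H.coe) (f := Subtype.val) ?_
      (hHconn.preconnected ⟨a, ha⟩ ⟨b, hb⟩)
    rintro ⟨c, hc⟩ ⟨d, hd⟩ hcd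
    exact ⟨H.adj_sub hcd, ⟨Or.inl hc, fun h => hX.le_bot ⟨h, hc⟩⟩,
      ⟨Or.inl hd, fun h => hX.le_bot ⟨h, hd⟩⟩⟩
  have hK : IsBiconnected ((⊤ : G.Subgraph).induce S).coe := by
    constructor
    · rw [SimpleGraph.connected_iff]
      refine ⟨preconnected_of_within ?_, ⟨⟨u, Or.inl hu⟩⟩⟩
      have := ear ∅ Set.subsingleton_empty (whole ∅ (Set.empty_disjoint _))
      rwa [Set.sdiff_empty] at this
    · rintro v ⟨-, hv⟩
      refine hv (induce_preconnected_of_within v (ear {v.1} Set.subsingleton_singleton ?_))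
      by_cases hvH : v.1 ∈ H.verts
      · have hpre : (H.coe.induce {(⟨v.1, hvH⟩ : H.verts)}ᶜ).Preconnected := by
          by_contra h
          exact hH.prop.2 _ ⟨hHconn, h⟩
        rintro a ⟨ha, hav⟩ b ⟨hb, hbv⟩
        refine within_reachable_of_reachable (L := H.coe.induce {(⟨v.1, hvH⟩ : H.verts)}ᶜ)
          (f := fun t => t.1.1) ?_
          (hpre ⟨⟨a, ha⟩, fun e => hav (congrArg Subtype.val e)⟩
            ⟨⟨b, hb⟩, fun e => hbv (congrArg Subtype.val e)⟩)
        rintro ⟨⟨c, hc⟩, hcv⟩ ⟨⟨d, hd⟩, hdv⟩ hcd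
        exact ⟨H.adj_sub hcd, ⟨Or.inl hc, fun e => hcv (Subtype.ext e)⟩,
          ⟨Or.inl hd, fun e => hdv (Subtype.ext e)⟩⟩
      · exact whole {v.1} (Set.disjoint_singleton_left.2 hvH)
  have hle : H ≤ (⊤ : G.Subgraph).induce S :=
    ⟨fun a ha => Or.inl ha, fun a b hab =>
      ⟨Or.inl (H.edge_vert hab), Or.inl (H.edge_vert hab.symm), H.adj_sub hab⟩⟩
  have hyH : y ∈ H.verts :=
    (hH.le_of_ge hK hle).1 (show y ∈ S from Or.inr ⟨p.length, le_rfl, hwn⟩)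
  exact hy.elim hyu fun h => h hyH

lemma attached_subset {H : G.Subgraph} {u v : V} (hv : v ∈ attached H u) :
    v ∈ insert u H.vertsᶜ := hv.1

lemma self_mem_attached (H : G.Subgraph) (u : V) : u ∈ attached H u :=
  ⟨Set.mem_insert u _, SimpleGraph.Reachable.refl _⟩

lemma mem_attached_of_adj {H : G.Subgraph} {u y z : V} (hy : y ∈ attached H u)
    (hz : z ∈ insert u H.vertsᶜ) (hyz : G.Adj y z) : z ∈ attached H u := by
  obtain ⟨hy', hr⟩ := hy
  refine ⟨hz, hr.trans ?_⟩
  have : (G.induce (insert u H.vertsᶜ)).Adj ⟨y, hy'⟩ ⟨z, hz⟩ := hyz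
  exact this.reachable

lemma IsBiconnectedComponent.mem_attached_of_adj {H : G.Subgraph}
    (hH : IsBiconnectedComponent H) {u y z : V} (hu : u ∈ H.verts) (hy : y ∈ attached H u)
    (hyu : y ≠ u) (hyz : G.Adj y z) : z ∈ attached H u := by
  by_cases hz : z ∈ insert u H.vertsᶜ
  · exact NetworkCreation.mem_attached_of_adj hy hz hyz
  · rw [Set.mem_insert_iff, not_or, Set.notMem_compl_iff] at hz
    obtain ⟨hy', hr⟩ := hy
    exact absurd hyz (hH.not_adj_ear hu hy' hyu hr hz.2 hz.1)

lemma exists_mem_attached (hG : G.Connected) {H : G.Subgraph} {h : V} (hh : h ∈ H.verts) (v : V) :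
    ∃ x ∈ H.verts, v ∈ attached H x := by
  obtain ⟨p⟩ := hG.preconnected v h
  induction p with
  | nil => exact ⟨_, hh, self_mem_attached H _⟩
  | cons hvw p ih =>
    rename_i v w h
    by_cases hv : v ∈ H.verts
    · exact ⟨v, hv, self_mem_attached H v⟩
    · obtain ⟨x, hx, hwx⟩ := ih hh
      exact ⟨x, hx, NetworkCreation.mem_attached_of_adj hwx (Or.inr hv) hvw.symm⟩

/-- Every edge leaving `T(u)` starts at `u`, so all paths into `T(u)` pass through `u`. -/
lemma IsBiconnectedComponent.dist_add_le (hG : G.Connected) {H : G.Subgraph}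
    (hH : IsBiconnectedComponent H) {u x z : V} (hu : u ∈ H.verts)
    (hx : x ∈ attached H u → x = u) (hz : z ∈ attached H u) :
    G.dist x u + G.dist u z ≤ G.dist x z := by
  classical
  have hout : ∀ c d, c ∈ attached H u → d ∉ attached H u → G.Adj c d → c = u := by
    intro c d hc hd hcd
    by_contra hcu
    exact hd (hH.mem_attached_of_adj hu hc hcu hcd)
  have := le_dist_of_lipschitz hG
    (fun z => if z ∈ attached H u then G.dist x u + G.dist u z else G.dist x z) (y := x) ?_ ?_ z
  · simpa [hz] using this
  · intro c d hcd
    have h1 := dist_le_dist_succ (hG.preconnected x c) hcd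
    by_cases hc : c ∈ attached H u <;> by_cases hd : d ∈ attached H u <;> simp only [hc, hd, if_true,
      if_false]
    · have := dist_le_dist_succ (hG.preconnected u c) hcd
      omega
    · obtain rfl := hout c d hc hd hcd
      omega
    · obtain rfl := hout d c hd hc hcd.symm
      rw [SimpleGraph.dist_self]
      omega
    · exact h1
  · by_cases h : x ∈ attached H u
    · obtain rfl := hx h
      simp
    · simp [h]

lemma IsNontrivialBiconnectedComponent.exists_other {H : G.Subgraph}
    (hH : IsNontrivialBiconnectedComponent H) {v y : V} (hvy : v ≠ y) (hv : v ∈ H.verts) :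
    ∃ w, w ≠ y ∧ H.Adj v w := by
  obtain ⟨c, hc, hcv, hcy⟩ : ∃ c ∈ H.verts, c ≠ v ∧ c ≠ y := by
    by_contra! h
    have hsub : H.verts ⊆ {v, y} := by
      intro c hc
      by_cases hcv : c = v
      · exact Or.inl hcv
      · exact Or.inr (h c hc hcv)
    have h1 := Set.encard_le_encard hsub
    rw [Set.encard_pair hvy] at h1
    exact absurd (hH.2.trans h1) (by decide)
  have hr : ∃ w, w ≠ y ∧ H.Adj v w := by
    by_cases hy : y ∈ H.verts
    · have hpre : (H.coe.induce {(⟨y, hy⟩ : H.verts)}ᶜ).Preconnected := by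
        by_contra h
        exact hH.1.prop.2 _ ⟨hH.1.prop.1, h⟩
      obtain ⟨p⟩ := hpre ⟨⟨v, hv⟩, fun e => hvy (congrArg Subtype.val e)⟩
        ⟨⟨c, hc⟩, fun e => hcy (congrArg Subtype.val e)⟩
      cases p with
      | nil => exact absurd rfl hcv
      | cons h p =>
        rename_i w
        exact ⟨w.1.1, fun e => w.2 (Subtype.ext e), h⟩
    · obtain ⟨p⟩ := hH.1.prop.1.preconnected ⟨v, hv⟩ ⟨c, hc⟩
      cases p with
      | nil => exact absurd rfl hcv
      | cons h p =>
        rename_i w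
        exact ⟨w.1, fun e => hy (e ▸ w.2), h⟩
  exact hr

/-- A vertex of `H` farthest from `r` has a neighbour in `H` that is not its parent, and by
maximality this neighbour is not its child either. -/
lemma IsNontrivialBiconnectedComponent.exists_nonTree [Finite V] {H : G.Subgraph}
    (hH : IsNontrivialBiconnectedComponent H) {r : V} {π : V → V} (hπ : IsParent G r π) :
    ∃ x y, H.Adj x y ∧ NonTree G π x y := by
  have hne : H.verts.Nonempty := by
    obtain ⟨v⟩ := hH.1.prop.1.nonempty
    exact ⟨v.1, v.2⟩
  obtain ⟨v, hv, hmax⟩ := Set.exists_max_image H.verts (fun v => G.dist r v) H.verts.toFinite hne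
  have key : ∀ w, H.Adj v w → w ≠ π v → NonTree G π v w := by
    intro w hw hwv
    refine ⟨H.adj_sub hw, hwv, ?_⟩
    rintro rfl
    have hwr : w ≠ r := by
      rintro rfl
      exact (H.adj_sub hw).ne hπ.root
    have h1 := hπ.dist w hwr
    have h2 := hmax w (H.edge_vert hw.symm)
    omega
  by_cases hvr : v = π v
  · have hex : ∃ y, v ≠ y := by
      by_contra! h
      have hsub : H.verts ⊆ {v} := fun c _ => (h c).symm
      have h1 := Set.encard_le_encard hsub
      rw [Set.encard_singleton] at h1
      exact absurd (hH.2.trans h1) (by decide)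
    obtain ⟨y, hy⟩ := hex
    obtain ⟨w, -, hw⟩ := hH.exists_other hy hv
    exact ⟨v, w, hw, key w hw fun e => (H.adj_sub hw).ne (hvr.trans e.symm)⟩
  · obtain ⟨w, hwv, hw⟩ := hH.exists_other hvr hv
    exact ⟨v, w, hw, key w hw hwv⟩

lemma edist_map_le {W : Type*} {K : SimpleGraph W} (f : K →g G) (a b : W) :
    G.edist (f a) (f b) ≤ K.edist a b := by
  by_cases h : K.Reachable a b
  · obtain ⟨p, hp⟩ := h.exists_walk_length_eq_edist
    rw [← hp, ← SimpleGraph.Walk.length_map f p]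
    exact SimpleGraph.edist_le _
  · rw [SimpleGraph.edist_eq_top_of_not_reachable h]
    exact le_top

end Ear

/-! ### Prices between `n` and `11n`, and the conclusion. -/

section Main

variable {V : Type*} [Fintype V] [DecidableEq V] {α : ℝ} {s : Profile V}

lemma dist_le_of_mem_attached_aux (hs : IsNashEquilibrium α s) (hα : (Fintype.card V : ℝ) < α)
    (hα' : α ≤ 11 * Fintype.card V)
    (hG : (network s).Connected) {H : (network s).Subgraph} (hH : IsBiconnectedComponent H)
    {u v x x' : V} (hu : u ∈ H.verts) (hv : v ∈ attached H u) {π : V → V}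
    (hπ : IsParent (network s) u π) (hx : x ∈ H.verts) (hx' : x' ∈ (s x).1)
    (hN : NonTree (network s) π x x') : (network s).dist u v ≤ 77 := by
  classical
  by_contra! hD
  have hn : (0 : ℝ) ≤ Fintype.card V := by positivity
  have hα0 : 0 ≤ α := hn.trans hα.le
  set q : ℝ := ∑ z, ind (z ∉ attached H u) with hq
  have hq0 : 0 ≤ q := Finset.sum_nonneg fun z _ => ind_nonneg _
  set δ : ℝ := ((network s).dist x u : ℝ) with hδ
  have hδ0 : 0 ≤ δ := by positivity
  have hxT : x ∈ attached H u → x = u := fun h =>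
    (attached_subset h).resolve_right fun h => h hx
  have lowx : ∀ z, z ∈ attached H u → (network s).dist x u + (network s).dist u z ≤ (network s).dist x z := fun z hz =>
    hH.dist_add_le hG hu hxT hz
  have trix : ∀ z, (network s).dist u z ≤ (network s).dist x u + (network s).dist x z := fun z => by
    rw [SimpleGraph.dist_comm (u := x) (v := u)]
    exact hG.dist_triangle
  have htree : ∀ G' : SimpleGraph V, (∀ c d, (network s).Adj c d → (c = x → d ∉ ({x'} : Finset V)) →
      (d = x → c ∉ ({x'} : Finset V)) → G'.Adj c d) → ∀ z, G'.edist u z ≤ ((network s).dist u z : ℕ) := by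
    intro G' hG'
    refine hπ.edist_le_of_nonTree hN fun c d hcd h1 h2 => hG' c d hcd ?_ ?_
    · rintro rfl; simpa using fun e => h1 ⟨rfl, e⟩
    · rintro rfl; simpa using fun e => h2 ⟨e, rfl⟩
  -- The tree rooted at `u` survives, so `x` can route everything through `u`. For targets in `T(u)`
  -- this is already a shortest route.
  have dev1 := hs.deviation hα0 hG x {x'} ∅ (by simpa using hx') (by simp)
    (fun z => (network s).dist x u + (network s).dist u z) (by
    intro G' hG' _ z
    have h1 := htree G' hG' x
    rw [SimpleGraph.edist_comm, SimpleGraph.dist_comm] at h1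
    calc G'.edist x z ≤ G'.edist x u + G'.edist u z := SimpleGraph.edist_triangle
      _ ≤ ((network s).dist x u : ℕ) + ((network s).dist u z : ℕ) := add_le_add h1 (htree G' hG' z)
      _ = _ := by push_cast; rfl)
  have pt1 : ∀ z, (((network s).dist x u + (network s).dist u z : ℕ) : ℝ) ≤
      (network s).dist x z + 2 * δ * ind (z ∉ attached H u) := by
    intro z
    by_cases hz : z ∈ attached H u
    · rw [ind_of_not (not_not.2 hz), mul_zero, add_zero]
      exact_mod_cast lowx z hz
    · rw [ind_of hz, hδ]
      have := trix z
      have : (network s).dist x u + (network s).dist u z ≤ (network s).dist x z + 2 * (network s).dist x u := by omega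
      rw [mul_one]
      exact_mod_cast this
  have s1 := Finset.sum_le_sum fun z (_ : z ∈ Finset.univ) => pt1 z
  rw [Finset.sum_add_distrib, ← Finset.mul_sum, ← hq] at s1
  have i1 : α ≤ 2 * δ * q := by
    simp only [Finset.card_singleton, Finset.card_empty, Nat.cast_one, Nat.cast_zero, mul_one,
      mul_zero, zero_add] at dev1
    linarith
  have hxu : u ≠ x := by
    rintro rfl
    rw [hδ, SimpleGraph.dist_self] at i1
    norm_num at i1
    linarith
  have dev2 := hs.deviation hα0 hG x {x'} {u} (by simpa using hx') (by simpa using hxu.symm)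
    (fun z => 1 + (network s).dist u z) (by
    intro G' hG' hA z
    calc G'.edist x z ≤ G'.edist x u + G'.edist u z := SimpleGraph.edist_triangle
      _ ≤ ((1 : ℕ) : ℕ∞) + ((network s).dist u z : ℕ) :=
        add_le_add (edist_le_of_adj (hA u (by simp)) le_rfl) (htree G' hG' z)
      _ = _ := by push_cast; rfl)
  have pt2 : ∀ z, ((network s).dist u z : ℝ) + (δ - 2 * δ * ind (z ∉ attached H u)) ≤ (network s).dist x z := by
    intro z
    by_cases hz : z ∈ attached H u
    · rw [ind_of_not (not_not.2 hz), mul_zero, sub_zero, hδ]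
      have := lowx z hz
      have : (network s).dist u z + (network s).dist x u ≤ (network s).dist x z := by omega
      exact_mod_cast this
    · rw [ind_of hz, hδ]
      have : ((network s).dist u z : ℝ) ≤ (network s).dist x u + (network s).dist x z := by exact_mod_cast trix z
      linarith
  have s2 := Finset.sum_le_sum fun z (_ : z ∈ Finset.univ) => pt2 z
  rw [Finset.sum_add_distrib, Finset.sum_sub_distrib, ← Finset.mul_sum, ← hq] at s2
  have i2 : δ * (Fintype.card V - 2 * q) ≤ Fintype.card V := by
    push_cast [Finset.sum_add_distrib] at dev2
    simp only [Finset.sum_const, Finset.card_univ, nsmul_eq_mul, Finset.card_singleton,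
      Nat.cast_one, mul_one] at dev2 s2
    linarith
  have hvu : v ≠ u := by
    rintro rfl
    simp at hD
  have dev3 := hs.deviation hα0 hG v ∅ {u} (by simp) (by simpa using hvu)
    -- Every shortest path from `v` to the outside of `T(u)` passes through `u`; with `d(u,v) ≥ 78`,
    -- a direct link saves at least 77 for each such target.
    (fun z => if z ∈ attached H u then (network s).dist v z else 1 + (network s).dist u z) (by
    intro G' hG' hA z
    have hle : network s ≤ G' := fun c d h => hG' c d h (by simp) (by simp)
    have hed : ∀ y z, G'.edist y z ≤ ((network s).dist y z : ℕ) := by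
      intro y z
      rw [(hG.preconnected y z).coe_dist_eq_edist]
      exact SimpleGraph.edist_anti hle
    by_cases hz : z ∈ attached H u
    · simp only [hz, if_true]
      exact hed v z
    · simp only [hz, if_false]
      calc G'.edist v z ≤ G'.edist v u + G'.edist u z := SimpleGraph.edist_triangle
        _ ≤ ((1 : ℕ) : ℕ∞) + ((network s).dist u z : ℕ) :=
          add_le_add (edist_le_of_adj (hA u (by simp)) le_rfl) (hed u z)
        _ = _ := by push_cast; rfl)
  have pt3 : ∀ z, ((if z ∈ attached H u then (network s).dist v z else 1 + (network s).dist u z : ℕ) : ℝ) +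
      77 * ind (z ∉ attached H u) ≤ (network s).dist v z := by
    intro z
    by_cases hz : z ∈ attached H u
    · rw [ind_of_not (not_not.2 hz), if_pos hz, mul_zero, add_zero]
    · rw [ind_of hz, if_neg hz]
      have h := hH.dist_add_le hG hu (x := z) (fun h => absurd h hz) hv
      rw [SimpleGraph.dist_comm (u := z) (v := u), SimpleGraph.dist_comm (u := z) (v := v)] at h
      have h' : 1 + (network s).dist u z + 77 * 1 ≤ (network s).dist v z := by omega
      exact_mod_cast h'
  have s3 := Finset.sum_le_sum fun z (_ : z ∈ Finset.univ) => pt3 z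
  rw [Finset.sum_add_distrib, ← Finset.mul_sum, ← hq] at s3
  have i3 : 77 * q ≤ α := by
    simp only [Finset.card_singleton, Finset.card_empty, Nat.cast_one, Nat.cast_zero, mul_one,
      mul_zero, zero_add] at dev3
    linarith
  have hq7 : 7 * q ≤ Fintype.card V := by linarith
  have := mul_le_mul_of_nonneg_left hq7 hδ0
  nlinarith

theorem dist_le_of_mem_attached (hs : IsNashEquilibrium α s) (hα : (Fintype.card V : ℝ) < α)
    (hG : (network s).Connected) {H : (network s).Subgraph}
    (hH : IsNontrivialBiconnectedComponent H) {u v : V} (hu : u ∈ H.verts)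
    (hv : v ∈ attached H u) : (network s).dist u v ≤ 77 := by
  obtain ⟨π, hπ⟩ := exists_isParent hG u
  obtain ⟨x, x', hxx', hN⟩ := hH.exists_nonTree hπ
  have hα' : α ≤ 11 * Fintype.card V := by
    by_contra! h
    exact not_nonBridge hs h hG x x' (hπ.nonBridge_of_nonTree hN)
  rcases H.adj_sub hxx' with h | h
  · exact dist_le_of_mem_attached_aux hs hα hα' hG hH.1 hu hv hπ (H.edge_vert hxx') h hN
  · exact dist_le_of_mem_attached_aux hs hα hα' hG hH.1 hu hv hπ (H.edge_vert hxx'.symm) h hN.symm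

end Main

end NetworkCreation

theorem mainTheorem9 {V : Type*} [Fintype V] [DecidableEq V] (α : ℝ)
    (hα : (Fintype.card V : ℝ) < α) (s : NetworkCreation.Profile V)
    (hs : NetworkCreation.IsNashEquilibrium α s)
    (H : (NetworkCreation.network s).Subgraph)
    (hH : NetworkCreation.IsNontrivialBiconnectedComponent H) :
    (∀ u ∈ H.verts, ∀ v ∈ NetworkCreation.attached H u,
      (NetworkCreation.network s).edist u v ≤ 77) ∧
    (NetworkCreation.network s).ediam ≤ H.coe.ediam + 154 := by
  obtain ⟨h, hh⟩ := hH.1.prop.1.nonempty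
  have : Nonempty V := ⟨h⟩
  have hG := hs.connected
  have key : ∀ u ∈ H.verts, ∀ v ∈ NetworkCreation.attached H u,
      (NetworkCreation.network s).edist u v ≤ 77 := by
    intro u hu v hv
    rw [← (hG.preconnected u v).coe_dist_eq_edist]
    exact_mod_cast NetworkCreation.dist_le_of_mem_attached hs hα hG hH hu hv
  -- Both ends are within 77 of their attachment vertices in `H`, and distances inside `H` bound
  -- those in the network.
  refine ⟨key, SimpleGraph.ediam_le_of_edist_le fun v w => ?_⟩
  obtain ⟨x, hx, hvx⟩ := NetworkCreation.exists_mem_attached hG hh v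
  obtain ⟨y, hy, hwy⟩ := NetworkCreation.exists_mem_attached hG hh w
  have h1 := key x hx v hvx
  have h2 := key y hy w hwy
  have h3 : (NetworkCreation.network s).edist x y ≤ H.coe.ediam :=
    (NetworkCreation.edist_map_le H.hom ⟨x, hx⟩ ⟨y, hy⟩).trans SimpleGraph.edist_le_ediam
  rw [SimpleGraph.edist_comm] at h1
  calc (NetworkCreation.network s).edist v w
      ≤ (NetworkCreation.network s).edist v y + (NetworkCreation.network s).edist y w :=
        SimpleGraph.edist_triangle
    _ ≤ ((NetworkCreation.network s).edist v x + (NetworkCreation.network s).edist x y) +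
        (NetworkCreation.network s).edist y w := by
        gcongr; exact SimpleGraph.edist_triangle
    _ ≤ (77 + H.coe.ediam) + 77 := by gcongr
    _ = H.coe.ediam + 154 := by
        rw [add_comm 77, add_assoc]; norm_num
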